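/- Let $u\colon R\to U$ be a flat epimorphism of commutative rings, that is, a homomorphism of commutative rings such that $U$ is a flat $R$-module and the multiplication map $U\otimes_R U\to U$ is an isomorphism. Let $\mathbb G$ be the set of all ideals $I\subset R$ such that $R/I\otimes_R U=0$. Assume that, for every $I\in\mathbb G$, the quotient ring $R/I$ has only finitely many maximal ideals and all its prime ideals are maximal. Let $\mathsf E$ be the class of all $R$-modules whose $R$-module structure is obtained by restriction of scalars from a $U$-module structure or from an $R/I$-module structure for some $I\in\mathbb G$. Say that an $R$-module is simply right obtainable from $\mathsf E$ if it belongs to the smallest class of $R$-modules that contains $\mathsf E$ and is closed under extensions, cokernels of monomorphisms, arbitrary products, and transfinitely iterated extensions in the sense of the projective limit. Here a class $\mathsf P$ is closed under the last operation if $X_\alpha\in\mathsf P$ for every ordinal $\alpha$ and every projective system of $R$-modules $(X_i)_{0\le i\le\alpha}$ such that $X_0=0$, the map $X_{i+1}\to X_i$ is surjective with kernel in $\mathsf P$ for every $i<\alpha$, and $X_j=\varprojlim_{i<j}X_i$ for every limit ordinal $j\le\alpha$. Then an $R$-module $C$ is $U$-weakly cotorsion, that is, satisfies $\operatorname{Ext}^1_R(U,C)=0$,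 if and only if $C$ is simply right obtainable from $\mathsf E$. -/

import Mathlib

open CategoryTheory
open scoped TensorProduct

universe u

/-- The set `𝔾` (the Gabriel filter attached to a flat epimorphism `R → U`) of all ideals `I` of `R` such that `R/I ⊗[R] U = 0`. -/
def gabrielFilter (R U : Type u) [CommRing R] [CommRing U] [Algebra R U] : Set (Ideal R) :=
  {I | Subsingleton ((R ⧸ I) ⊗[R] U)}

/-- A commutative ring is semilocal if it has only finitely many maximal ideals. -/
def IsSemilocal (T : Type u) [CommRing T] : Prop :=
  {m : Ideal T | m.IsMaximal}.Finite

/-- All prime ideals are maximal (the zero ring is included). -/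
def HasKrullDimZero (T : Type u) [CommRing T] : Prop :=
  ∀ p : Ideal T, p.IsPrime → p.IsMaximal

/-- `R` is `F`-h-nil: for every `I ∈ F`, the ring `R/I` is semilocal of Krull dimension zero. -/
def IsHNil {R : Type u} [CommRing R] (F : Set (Ideal R)) : Prop :=
  ∀ I ∈ F, IsSemilocal (R ⧸ I) ∧ HasKrullDimZero (R ⧸ I)

section Modules

variable (R : Type u) [CommRing R]

/-- The class of all `R`-modules whose `R`-module structure comes, by restriction of scalars,
from some `A`-module structure. -/
def underlyingModules (A : Type u) [CommRing A] [Algebra R A] :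
    ObjectProperty (ModuleCat.{u} R) :=
  fun M => ∃ _ : Module A M, IsScalarTower R A M

/-- `C` is `U`-weakly cotorsion: `Ext¹_R(U, C) = 0`. -/
def IsWeaklyCotorsion (U : Type u) [CommRing U] [Algebra R U] :
    ObjectProperty (ModuleCat.{u} R) :=
  fun C => Subsingleton (Abelian.Ext.{u} (ModuleCat.of R U) C 1)

variable {R}

/-- The class of `R`-modules that are `U`-modules, or `R/I`-modules for some `I ∈ 𝔾`. -/
def basicModules (U : Type u) [CommRing U] [Algebra R U] : ObjectProperty (ModuleCat.{u} R) :=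
  fun M => underlyingModules R U M ∨ ∃ I ∈ gabrielFilter R U, underlyingModules R (R ⧸ I) M

/-- A projective system `(X i)`, `i ≤ α`, of `R`-modules exhibiting `X α` as a transfinitely
iterated extension, in the sense of the projective limit, of modules from the class `P`:
`X 0 = 0`; for `i < α` the map `X (i + 1) → X i` is surjective with kernel in `P`;
and `X j = lim_{i < j} X i` for every limit ordinal `j ≤ α`. -/
structure IsIteratedExtension (P : ObjectProperty (ModuleCat.{u} R)) (α : Ordinal.{u})
    (X : (Set.Iic α)ᵒᵖ ⥤ ModuleCat.{u} R) : Prop where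
  zero : ∀ i : Set.Iic α, i.1 = 0 → Subsingleton (X.obj (.op i))
  surjective : ∀ (i k : Set.Iic α) (h : i ≤ k), k.1 = i.1 + 1 →
    Function.Surjective (X.map (homOfLE h).op)
  kernel : ∀ (i k : Set.Iic α) (h : i ≤ k), k.1 = i.1 + 1 →
    P (ModuleCat.of R (LinearMap.ker (X.map (homOfLE h).op).hom))
  limit : ∀ j : Set.Iic α, Order.IsSuccLimit j.1 →
    ∀ x : (∀ i : Set.Iio j, X.obj (.op i.1)),
      (∀ (i k : Set.Iio j) (h : i.1 ≤ k.1), X.map (homOfLE h).op (x k) = x i) →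
      ∃! y : X.obj (.op j), ∀ i : Set.Iio j, X.map (homOfLE i.2.le).op y = x i

/-- The class `P` is closed under extensions, cokernels of monomorphisms, infinite products,
and transfinitely iterated extensions in the sense of the projective limit. -/
structure IsRightClosed (P : ObjectProperty (ModuleCat.{u} R)) : Prop where
  extension : ∀ S : ShortComplex (ModuleCat.{u} R), S.ShortExact → P S.X₁ → P S.X₃ → P S.X₂
  cokernel : ∀ S : ShortComplex (ModuleCat.{u} R), S.ShortExact → P S.X₁ → P S.X₂ → P S.X₃
  product : ∀ (ι : Type u) (M : ι → ModuleCat.{u} R), (∀ i, P (M i)) →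
    P (ModuleCat.of R (∀ i, M i))
  iteratedExtension : ∀ (α : Ordinal.{u}) (X : (Set.Iic α)ᵒᵖ ⥤ ModuleCat.{u} R),
    IsIteratedExtension P α X → P (X.obj (.op ⟨α, le_refl α⟩))

/-- `C` is simply right obtainable from the class `E`: it belongs to the smallest class containing
`E` and closed under extensions, cokernels of monomorphisms, infinite products,
and transfinitely iterated extensions in the sense of the projective limit. -/
def SimplyRightObtainable (E : ObjectProperty (ModuleCat.{u} R)) :
    ObjectProperty (ModuleCat.{u} R) :=
  fun C => ∀ P : ObjectProperty (ModuleCat.{u} R), IsRightClosed P → (∀ M, E M → P M) → P C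

end Modules

/-! ### Vanishing of Ext¹ in concrete form, and its permanence properties. -/

section ExtVanishing

variable {R : Type u} [CommRing R]

/-! Easy half. It suffices to exhibit one right closed class that contains the basic modules and
consists of weakly cotorsion modules. Orthogonality to `U` alone is not enough for the argument:
closure under cokernels involves Ext². Instead one takes the modules right orthogonal to every flat
`M` for which `U ⊗ M` is `U`-projective and each `R/I ⊗ M` with `I ∈ 𝔾` is `R/I`-projective
(`IsRelativelyProjective`). Such `M` are stable under syzygies, which settles cokernels; a dual
Eklof argument settles iterated extensions; and since the free cover of `M` splits after base change
to `U` or `R/I`, the basic modules belong to the class. Finally `U` is such an `M`, because `U ⊗ U =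
U` and `R/I ⊗ U = 0`.

Hard half. For each maximal `m ∈ 𝔾` choose a finite `t ⊆ m` generating an ideal of `𝔾` above which
`m` is the only maximal ideal. Let `F_{m,n}` (`Fractions`) consist of the `u` in `U` together with
compatible numerators in `R` of all `s ^ n • u`, `s ∈ t`; the numerators are part of the data
because `R → U` need not be injective. The h-nil hypothesis makes `U` the amalgam over `R`, over all
`m`, of the colimits of the `F_{m,n}` in `n`. With `F = ⨁ F_{m,n}` this is a short exact sequence `0
→ R^(𝔪) ⊕ F → R ⊕ F → U → 0`, where `𝔪` is the set of these `m`, checked locally at maximal ideals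
(`relations_injective`, `relations_exact`, `toTarget_surjective`). Hence Ext¹(U, C) = 0 makes every
system of telescope equations in `C` solvable (`exists_telescope_solution`).

Let `D_{m,n} ⊆ C` be the image of `φ ↦ φ(1)` on Hom(F_{m,n}, C). It contains `s ^ n C`, so
`C/D_{m,n}` is a module over a quotient of `R` by an ideal of `𝔾`, and the telescope equations make
`C → ∏_m lim_n C/D_{m,n}` surjective, with kernel `H = ⋂ D_{m,n}`. To obtain `H`, let `Q` be the
module of families of maps `F_{m,n} → C` with a common value at `1` whose failure of compatibility
lies in modules `K_{m,n}` killed by the `s ^ n` (`almostCompatible`, `restrictedKernel`). There are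
exact sequences `0 → ∏ K → Q → H → 0` and `0 → Hom(U, C) → Q → ∏ K → 0`, the latter exact on the
right by the telescope equations again. So `Q`, then `H`, then `C` are obtainable. -/

/-- The canonical free cover of a module. -/
noncomputable abbrev freeCover (R : Type u) [CommRing R] (M : Type u) [AddCommGroup M] [Module R M] :
    (M →₀ R) →ₗ[R] M :=
  Finsupp.linearCombination R id

theorem freeCover_surjective (R : Type u) [CommRing R] (M : Type u) [AddCommGroup M] [Module R M] :
    Function.Surjective (freeCover R M) :=
  Finsupp.linearCombination_id_surjective R M

/-- The first syzygy module of the canonical free cover. -/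
def Syzygy (R : Type u) [CommRing R] (M : Type u) [AddCommGroup M] [Module R M] : Type u :=
  LinearMap.ker (freeCover R M)

noncomputable instance (M : Type u) [AddCommGroup M] [Module R M] : AddCommGroup (Syzygy R M) :=
  inferInstanceAs (AddCommGroup (LinearMap.ker (freeCover R M)))

noncomputable instance (M : Type u) [AddCommGroup M] [Module R M] : Module R (Syzygy R M) :=
  inferInstanceAs (Module R (LinearMap.ker (freeCover R M)))

/-- The inclusion of the syzygy module into the canonical free cover. -/
noncomputable def syzygyIncl (R : Type u) [CommRing R] (M : Type u) [AddCommGroup M] [Module R M] :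
    Syzygy R M →ₗ[R] M →₀ R :=
  (LinearMap.ker (freeCover R M)).subtype

theorem syzygyIncl_injective (R : Type u) [CommRing R] (M : Type u) [AddCommGroup M]
    [Module R M] : Function.Injective (syzygyIncl R M) :=
  (LinearMap.ker (freeCover R M)).injective_subtype

theorem syzygyIncl_exact (R : Type u) [CommRing R] (M : Type u) [AddCommGroup M]
    [Module R M] : Function.Exact (syzygyIncl R M) (freeCover R M) :=
  LinearMap.exact_subtype_ker_map (freeCover R M)

/-- A concrete form of the condition `Ext¹(M, C) = 0`: every linear map from the syzygy module of
`M` to `C` extends to the free cover. -/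
def ExtVanishes (R : Type u) [CommRing R] (M C : Type u) [AddCommGroup M] [Module R M]
    [AddCommGroup C] [Module R C] : Prop :=
  ∀ f : Syzygy R M →ₗ[R] C, ∃ g : (M →₀ R) →ₗ[R] C, ∀ x, g (syzygyIncl R M x) = f x

variable {M : Type u} [AddCommGroup M] [Module R M]
  {A B C : Type u} [AddCommGroup A] [Module R A] [AddCommGroup B] [Module R B]
  [AddCommGroup C] [Module R C]

theorem LinearMap.exists_factor_of_exact {N : Type u} [AddCommGroup N] [Module R N]
    {i : A →ₗ[R] B} {p : B →ₗ[R] C} (hi : Function.Injective i) (he : Function.Exact i p)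
    (f : N →ₗ[R] B) (hf : ∀ x, p (f x) = 0) : ∃ g : N →ₗ[R] A, ∀ x, i (g x) = f x := by
  have h : ∀ x, f x ∈ LinearMap.range i := fun x => (he (f x)).1 (hf x)
  refine ⟨(LinearEquiv.ofInjective i hi).symm.toLinearMap ∘ₗ f.codRestrict _ h, fun x => ?_⟩
  exact congrArg Subtype.val ((LinearEquiv.ofInjective i hi).apply_symm_apply
    (f.codRestrict _ h x))

theorem ExtVanishes.extension {i : A →ₗ[R] B} {p : B →ₗ[R] C} (hi : Function.Injective i)
    (he : Function.Exact i p) (hp : Function.Surjective p)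
    (hA : ExtVanishes R M A) (hC : ExtVanishes R M C) : ExtVanishes R M B := by
  intro f
  obtain ⟨g, hg⟩ := hC (p ∘ₗ f)
  obtain ⟨g', hg'⟩ := Module.projective_lifting_property p g hp
  obtain ⟨h, hh⟩ := LinearMap.exists_factor_of_exact (N := Syzygy R M) hi he
    (f - g' ∘ₗ syzygyIncl R M) (fun x => by
      have h1 := hg x
      rw [← hg'] at h1
      rw [LinearMap.comp_apply, LinearMap.comp_apply] at h1
      rw [LinearMap.sub_apply, map_sub]
      exact sub_eq_zero.2 h1.symm)
  obtain ⟨k, hk⟩ := hA h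
  refine ⟨g' + i ∘ₗ k, fun x => ?_⟩
  simp [hk, hh]

theorem LinearMap.exists_factor_of_surjective {N : Type u} [AddCommGroup N] [Module R N]
    {i : A →ₗ[R] B} {p : B →ₗ[R] C} (he : Function.Exact i p) (hp : Function.Surjective p)
    (f : B →ₗ[R] N) (hf : ∀ x, f (i x) = 0) : ∃ g : C →ₗ[R] N, ∀ x, g (p x) = f x := by
  have h : LinearMap.ker p ≤ LinearMap.ker f := fun x hx => by
    obtain ⟨y, rfl⟩ := (he x).1 hx
    exact hf y
  let e := LinearMap.quotKerEquivOfSurjective p hp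
  refine ⟨(LinearMap.ker p).liftQ f h ∘ₗ e.symm.toLinearMap, fun x => ?_⟩
  have h3 : e.symm (p x) = Submodule.Quotient.mk x := by
    rw [LinearEquiv.symm_apply_eq]; rfl
  rw [LinearMap.comp_apply, LinearEquiv.coe_coe, h3, Submodule.liftQ_apply]

/-- The obstruction lies in Ext²(M, A) = Ext¹(Syz M, A), which is why the hypothesis on `A` concerns
the syzygy: it allows `f` to be lifted along `p`, after which the lift extends by the hypothesis on
`B`. -/
theorem ExtVanishes.cokernel {i : A →ₗ[R] B} {p : B →ₗ[R] C} (hi : Function.Injective i)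
    (he : Function.Exact i p) (hp : Function.Surjective p)
    (hA : ExtVanishes R (Syzygy R M) A) (hB : ExtVanishes R M B) : ExtVanishes R M C := by
  intro f
  obtain ⟨f', hf'⟩ := Module.projective_lifting_property p (f ∘ₗ freeCover R (Syzygy R M)) hp
  have hf'' : ∀ x, p (f' x) = f (freeCover R (Syzygy R M) x) := LinearMap.congr_fun hf'
  obtain ⟨h, hh⟩ := LinearMap.exists_factor_of_exact hi he
    (f' ∘ₗ syzygyIncl R (Syzygy R M)) (fun x => by
      rw [LinearMap.comp_apply, hf'', (syzygyIncl_exact R _).apply_apply_eq_zero, map_zero])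
  obtain ⟨k, hk⟩ := hA h
  obtain ⟨d, hd⟩ := LinearMap.exists_factor_of_surjective (syzygyIncl_exact R (Syzygy R M))
    (freeCover_surjective R (Syzygy R M)) (f' - i ∘ₗ k) (fun x => by
      rw [LinearMap.sub_apply, LinearMap.comp_apply, hk, hh, LinearMap.comp_apply, sub_self])
  obtain ⟨g, hg⟩ := hB d
  refine ⟨p ∘ₗ g, fun x => ?_⟩
  obtain ⟨y, rfl⟩ := freeCover_surjective R (Syzygy R M) x
  rw [LinearMap.comp_apply, hg, hd, LinearMap.sub_apply, map_sub, LinearMap.comp_apply,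
    he.apply_apply_eq_zero, sub_zero, hf'']

theorem ExtVanishes.pi {ι : Type u} {C : ι → Type u} [∀ i, AddCommGroup (C i)]
    [∀ i, Module R (C i)] (h : ∀ i, ExtVanishes R M (C i)) : ExtVanishes R M (∀ i, C i) := by
  intro f
  choose g hg using fun i => h i (LinearMap.proj i ∘ₗ f)
  exact ⟨LinearMap.pi g, fun x => funext fun i => hg i x⟩

section Iterated

/-- The dual of Eklof's lemma. Compatible extensions to the stages are built by transfinite
recursion: at a successor a lift is corrected by a map into the kernel, at a limit the universal
property applies. -/
theorem ExtVanishes.iteratedExtension {P : ObjectProperty (ModuleCat.{u} R)}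
    (hP : ∀ N, P N → ExtVanishes R M N) {α : Ordinal.{u}} {X : (Set.Iic α)ᵒᵖ ⥤ ModuleCat.{u} R}
    (hX : IsIteratedExtension P α X) :
    ExtVanishes R M (X.obj (.op ⟨α, le_refl α⟩)) := by
  classical
  intro f
  have hle : ∀ i : Set.Iic α, i ≤ ⟨α, le_refl α⟩ := fun i => i.2
  let fi : ∀ i : Set.Iic α, Syzygy R M →ₗ[R] X.obj (.op i) := fun i =>
    (X.map (homOfLE (hle i)).op).hom ∘ₗ f
  have hcomp : ∀ (i j k : Set.Iic α) (hij : i ≤ j) (hjk : j ≤ k) (x : X.obj (.op k)),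
      X.map (homOfLE hij).op (X.map (homOfLE hjk).op x) = X.map (homOfLE (hij.trans hjk)).op x := by
    intro i j k hij hjk x
    rw [← ConcreteCategory.comp_apply, ← X.map_comp]
    rfl
  have hid : ∀ (i : Set.Iic α) (x : X.obj (.op i)), X.map (homOfLE (le_refl i)).op x = x := by
    intro i x
    have : (homOfLE (le_refl i)).op = 𝟙 (Opposite.op i) := rfl
    rw [this, X.map_id]; rfl
  have hfi : ∀ (i j : Set.Iic α) (hij : i ≤ j) (x), X.map (homOfLE hij).op (fi j x) = fi i x :=
    fun i j hij x => hcomp _ _ _ _ _ _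
  let Spec : ∀ i : Set.Iic α, (∀ j, j < i → ((M →₀ R) →ₗ[R] X.obj (.op j))) →
      ((M →₀ R) →ₗ[R] X.obj (.op i)) → Prop := fun i ih g =>
    (∀ x, g (syzygyIncl R M x) = fi i x) ∧
      ∀ (j) (hj : j < i) (x), X.map (homOfLE hj.le).op (g x) = ih j hj x
  -- The default value `0` never occurs: `key` shows that a map with the required property always
  -- exists.
  let step : ∀ i : Set.Iic α, (∀ j, j < i → ((M →₀ R) →ₗ[R] X.obj (.op j))) →
      ((M →₀ R) →ₗ[R] X.obj (.op i)) := fun i ih =>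
    if h : ∃ g, Spec i ih g then h.choose else 0
  let G : ∀ i : Set.Iic α, ((M →₀ R) →ₗ[R] X.obj (.op i)) :=
    WellFounded.fix (wellFounded_lt (α := Set.Iic α)) step
  have hG : ∀ i, G i = step i (fun j _ => G j) := fun i =>
    WellFounded.fix_eq (wellFounded_lt (α := Set.Iic α)) step i
  have key : ∀ i : Set.Iic α, Spec i (fun j _ => G j) (G i) := by
    intro i
    induction i using WellFoundedLT.induction with
    | ind i ih =>
    suffices hex : ∃ g, Spec i (fun j _ => G j) g by
      have : G i = hex.choose := by rw [hG i]; exact dif_pos hex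
      rw [this]
      exact hex.choose_spec
    rcases Ordinal.zero_or_succ_or_isSuccLimit i.1 with h0 | ⟨k, hk⟩ | hlim
    · have := hX.zero i h0
      refine ⟨0, fun x => Subsingleton.elim _ _, fun j hj => ?_⟩
      exact absurd (show j.1 < i.1 from hj) (by rw [h0]; exact not_lt_bot)
    · have hki : k < i.1 := by rw [← hk]; exact Order.lt_succ k
      let k' : Set.Iic α := ⟨k, hki.le.trans i.2⟩
      have hki' : k' < i := hki
      have hik : i.1 = k'.1 + 1 := by rw [← hk]; rfl
      obtain ⟨hk1, hk2⟩ := ih k' hki'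
      have hs := hX.surjective k' i hki'.le hik
      have hker := hP _ (hX.kernel k' i hki'.le hik)
      obtain ⟨g', hg'⟩ := Module.projective_lifting_property
        (X.map (homOfLE hki'.le).op).hom (G k') hs
      have hg'' : ∀ x, X.map (homOfLE hki'.le).op (g' x) = G k' x := LinearMap.congr_fun hg'
      -- The amount by which the lift `g'` fails to extend `fi i`; it dies at the previous stage,
      -- hence lies in the kernel, through which it can be extended and added back.
      let d : Syzygy R M →ₗ[R] LinearMap.ker (X.map (homOfLE hki'.le).op).hom :=
        (fi i - g' ∘ₗ syzygyIncl R M).codRestrict _ (fun x => by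
          rw [LinearMap.mem_ker]
          have h1 := hfi k' i hki'.le x
          have h2 := hg'' (syzygyIncl R M x)
          rw [hk1 x] at h2
          simp only [LinearMap.sub_apply, map_sub, LinearMap.coe_comp, Function.comp_apply]
          exact sub_eq_zero.2 (h1.trans h2.symm))
      obtain ⟨h, hh⟩ := hker d
      refine ⟨g' + (LinearMap.ker (X.map (homOfLE hki'.le).op).hom).subtype ∘ₗ h,
        fun x => ?_, fun j hj x => ?_⟩
      · have := congrArg Subtype.val (hh x)
        simp only [LinearMap.add_apply, LinearMap.coe_comp, Function.comp_apply,
          Submodule.coe_subtype]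
        rw [this]
        simp [d]
      · have hjk : j ≤ k' := by
          have : j.1 < k + 1 := by
            have h1 : j.1 < i.1 := hj
            rw [hik] at h1; exact h1
          exact (Order.lt_succ_iff (α := Ordinal)).1 this
        have hz : X.map (homOfLE hki'.le).op ((h x : _)) = 0 := LinearMap.mem_ker.1 (h x).2
        rw [← hcomp j k' i hjk hki'.le]
        simp only [LinearMap.add_apply, LinearMap.coe_comp, Function.comp_apply,
          Submodule.coe_subtype, map_add, hz, hg'', add_zero]
        rcases hjk.eq_or_lt with rfl | hlt
        · exact hid _ _
        · exact hk2 j hlt x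
    · have hcompat : ∀ (x) (j k : Set.Iio i) (h : j.1 ≤ k.1),
          X.map (homOfLE h).op (G k.1 x) = G j.1 x := by
        intro x j k h
        rcases h.eq_or_lt with h' | hlt
        · obtain ⟨j, hj⟩ := j
          obtain ⟨k, hk⟩ := k
          obtain rfl : j = k := h'
          exact hid _ _
        · exact (ih k.1 k.2).2 j.1 hlt x
      choose g hg hguniq using fun x => hX.limit i hlim (fun j => G j.1 x)
        (fun j k h => hcompat x j k h)
      refine ⟨{ toFun := g, map_add' := fun x y => ?_, map_smul' := fun r x => ?_ },
        fun x => ?_, fun j hj x => hg x ⟨j, hj⟩⟩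
      · exact (hguniq _ _ fun j => by simp only [map_add, hg]).symm
      · exact (hguniq _ _ fun j => by simp only [map_smul, hg, RingHom.id_apply]).symm
      · refine (hguniq _ _ fun j => ?_).symm
        simp only
        rw [hfi, (ih j.1 j.2).1]
  refine ⟨G ⟨α, le_refl α⟩, fun x => ?_⟩
  rw [(key ⟨α, le_refl α⟩).1 x]
  exact hid _ _

end Iterated

end ExtVanishing

/-! ### Flat modules that become projective after base change. -/

section Relative

variable {R : Type u} [CommRing R] (M : Type u) [AddCommGroup M] [Module R M]

/-- This is Tor₁(A, M) = 0, by a diagram chase with a free cover of `A`. -/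
theorem lTensor_injective_of_exact_of_flat {N F M : Type u} [AddCommGroup N] [Module R N]
    [AddCommGroup F] [Module R F] [AddCommGroup M] [Module R M] [Module.Flat R M]
    {i : N →ₗ[R] F} {p : F →ₗ[R] M} (hi : Function.Injective i) (he : Function.Exact i p)
    (hp : Function.Surjective p) (A : Type u) [AddCommGroup A] [Module R A] :
    Function.Injective (i.lTensor A) :=
  lTensor_injective_of_exact_of_exact_of_rTensor_injective (M₁ := Syzygy R A) (M₂ := A →₀ R)
    (N₃ := M)
    (syzygyIncl_exact R A) (freeCover_surjective R A) he hp
    (Module.Flat.rTensor_preserves_injective_linearMap _ (syzygyIncl_injective R A))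
    (Module.Flat.lTensor_preserves_injective_linearMap _ hi)

theorem Module.Flat.of_exact {N F M : Type u} [AddCommGroup N] [Module R N]
    [AddCommGroup F] [Module R F] [AddCommGroup M] [Module R M] [Module.Flat R F] [Module.Flat R M]
    {i : N →ₗ[R] F} {p : F →ₗ[R] M} (hi : Function.Injective i) (he : Function.Exact i p)
    (hp : Function.Surjective p) : Module.Flat R N := by
  rw [Module.Flat.iff_rTensor_preserves_injective_linearMap]
  intro X Y _ _ _ _ f hf
  have h1 : Function.Injective (f.rTensor F ∘ₗ i.lTensor X) :=
    (Module.Flat.rTensor_preserves_injective_linearMap f hf).comp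
      (lTensor_injective_of_exact_of_flat hi he hp X)
  rw [LinearMap.rTensor_comp_lTensor, ← LinearMap.lTensor_comp_rTensor] at h1
  exact Function.Injective.of_comp h1

variable [Module.Flat R M] (A : Type u) [CommRing A] [Algebra R A]

theorem exists_retraction_of_exact {A X Y Z : Type u} [CommRing A] [AddCommGroup X] [Module A X]
    [AddCommGroup Y] [Module A Y] [AddCommGroup Z] [Module A Z] [Module.Projective A Z]
    {i : X →ₗ[A] Y} {p : Y →ₗ[A] Z} (hi : Function.Injective i) (he : Function.Exact i p)
    (hp : Function.Surjective p) : ∃ ρ : Y →ₗ[A] X, ∀ x, ρ (i x) = x := by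
  obtain ⟨σ, hσ⟩ := Module.projective_lifting_property p LinearMap.id hp
  have hσ' : ∀ x, p (σ x) = x := LinearMap.congr_fun hσ
  obtain ⟨ρ, hρ⟩ := LinearMap.exists_factor_of_exact hi he (LinearMap.id - σ ∘ₗ p) (fun x => by
    rw [LinearMap.sub_apply, map_sub, LinearMap.comp_apply, hσ', LinearMap.id_apply, sub_self])
  refine ⟨ρ, fun x => hi ?_⟩
  rw [hρ, LinearMap.sub_apply, LinearMap.comp_apply, he.apply_apply_eq_zero, map_zero, sub_zero,
    LinearMap.id_apply]

/-- Flatness of `M` keeps the sequence exact over `A`, and projectivity of `A ⊗ M` splits it. -/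
theorem exists_retraction_baseChange {N F M : Type u} [AddCommGroup N] [Module R N]
    [AddCommGroup F] [Module R F] [AddCommGroup M] [Module R M] [Module.Flat R M]
    {i : N →ₗ[R] F} {p : F →ₗ[R] M} (hi : Function.Injective i) (he : Function.Exact i p)
    (hp : Function.Surjective p) (A : Type u) [CommRing A] [Algebra R A]
    [Module.Projective A (A ⊗[R] M)] :
    ∃ ρ : A ⊗[R] F →ₗ[A] A ⊗[R] N, ∀ x, ρ (i.baseChange A x) = x := by
  have h1 : Function.Injective (i.baseChange A) := lTensor_injective_of_exact_of_flat hi he hp A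
  have h2 : Function.Exact (i.baseChange A) (p.baseChange A) := lTensor_exact A he hp
  have h3 : Function.Surjective (p.baseChange A) := LinearMap.lTensor_surjective A hp
  exact exists_retraction_of_exact h1 h2 h3

theorem exists_retraction_baseChange_syzygy [Module.Projective A (A ⊗[R] M)] :
    ∃ ρ : A ⊗[R] (M →₀ R) →ₗ[A] A ⊗[R] Syzygy R M,
      ∀ x, ρ ((syzygyIncl R M).baseChange A x) = x :=
  exists_retraction_baseChange (syzygyIncl_injective R M) (syzygyIncl_exact R M)
    (freeCover_surjective R M) A

theorem projective_baseChange_syzygy [Module.Projective A (A ⊗[R] M)] :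
    Module.Projective A (A ⊗[R] Syzygy R M) := by
  obtain ⟨ρ, hρ⟩ := exists_retraction_baseChange_syzygy (R := R) M A
  exact Module.Projective.of_split _ ρ (LinearMap.ext hρ)

/-- Maps to an `A`-module factor through base change to `A`, where the inclusion of the syzygy has a
retraction; composing with it extends any map. -/
theorem extVanishes_of_isScalarTower [Module.Projective A (A ⊗[R] M)] (N : Type u)
    [AddCommGroup N] [Module R N] [Module A N] [IsScalarTower R A N] : ExtVanishes R M N := by
  intro f
  obtain ⟨ρ, hρ⟩ := exists_retraction_baseChange_syzygy (R := R) M A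
  refine ⟨((f.liftBaseChange A ∘ₗ ρ).restrictScalars R) ∘ₗ TensorProduct.mk R A (M →₀ R) 1,
    fun x => ?_⟩
  have := hρ (1 ⊗ₜ x)
  rw [LinearMap.baseChange_tmul] at this
  simp [this]

end Relative

/-! ### Comparison with categorical Ext, and the easy implication. -/

section Weak

variable {R : Type u} [CommRing R]

theorem exists_extension_of_subsingleton_ext {P₁ P₀ M : Type u} [AddCommGroup P₁] [Module R P₁]
    [AddCommGroup P₀] [Module R P₀] [AddCommGroup M] [Module R M] {i : P₁ →ₗ[R] P₀}
    {p : P₀ →ₗ[R] M} (hi : Function.Injective i) (he : Function.Exact i p)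
    (hp : Function.Surjective p) {C : ModuleCat.{u} R}
    [Subsingleton (Abelian.Ext.{u} (ModuleCat.of R M) C 1)] (f : P₁ →ₗ[R] C) :
    ∃ g : P₀ →ₗ[R] C, ∀ x, g (i x) = f x := by
  let S : ShortComplex (ModuleCat.{u} R) := ShortComplex.mk (ModuleCat.ofHom i) (ModuleCat.ofHom p)
    (by ext x; exact he.apply_apply_eq_zero x)
  have hS : S.ShortExact := ModuleCat.shortComplex_shortExact S he hi hp
  obtain ⟨y, hy⟩ := Abelian.Ext.contravariant_sequence_exact₁ hS C
    (Abelian.Ext.mk₀ (ModuleCat.ofHom f : S.X₁ ⟶ C)) (n₁ := 1) rfl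
    (Subsingleton.elim (α := Abelian.Ext.{u} (ModuleCat.of R M) C 1) _ _)
  obtain ⟨g, rfl⟩ := (Abelian.Ext.mk₀_bijective _ _).2 y
  rw [Abelian.Ext.mk₀_comp_mk₀] at hy
  have := (Abelian.Ext.mk₀_bijective _ _).1 hy
  exact ⟨g.hom, fun x => congr($(this) x)⟩

theorem ExtVanishes.subsingleton_ext {M : Type u} [AddCommGroup M] [Module R M]
    {C : ModuleCat.{u} R} (h : ExtVanishes R M C) :
    Subsingleton (Abelian.Ext.{u} (ModuleCat.of R M) C 1) := by
  let S : ShortComplex (ModuleCat.{u} R) := ShortComplex.mk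
    (ModuleCat.ofHom (syzygyIncl R M)) (ModuleCat.ofHom (freeCover R M))
    (by ext x; exact (syzygyIncl_exact R M).apply_apply_eq_zero x)
  have hS : S.ShortExact := ModuleCat.shortComplex_shortExact S (syzygyIncl_exact R M)
    (syzygyIncl_injective R M) (freeCover_surjective R M)
  have : Projective S.X₂ :=
    ModuleCat.projective_of_categoryTheory_projective (ModuleCat.of R (M →₀ R))
  refine subsingleton_of_forall_eq 0 fun x => ?_
  obtain ⟨y, rfl⟩ := Abelian.Ext.contravariant_sequence_exact₃ hS C x
    (Abelian.Ext.eq_zero_of_projective _) (n₀ := 0) rfl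
  obtain ⟨f, rfl⟩ := (Abelian.Ext.mk₀_bijective _ _).2 y
  obtain ⟨g, hg⟩ := h f.hom
  have : f = S.f ≫ ModuleCat.ofHom g := by ext x; exact (hg x).symm
  rw [this, ← Abelian.Ext.mk₀_comp_mk₀]
  exact hS.extClass_comp_assoc _

/-- Flat modules that become projective after base change to `U` and to `R/I` for all `I` in the
Gabriel filter. -/
structure IsRelativelyProjective (R U : Type u) [CommRing R] [CommRing U] [Algebra R U]
    (M : Type u) [AddCommGroup M] [Module R M] : Prop where
  flat : Module.Flat R M
  projective : Module.Projective U (U ⊗[R] M)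
  projective_quotient : ∀ I ∈ gabrielFilter R U, Module.Projective (R ⧸ I) ((R ⧸ I) ⊗[R] M)

variable {U : Type u} [CommRing U] [Algebra R U]

/-- The split base-changed sequence makes the syzygy a summand of a free module. This stability is
what closure under cokernels requires. -/
theorem IsRelativelyProjective.syzygy {M : Type u} [AddCommGroup M] [Module R M]
    (h : IsRelativelyProjective R U M) : IsRelativelyProjective R U (Syzygy R M) := by
  obtain ⟨h1, h2, h3⟩ := h
  exact ⟨Module.Flat.of_exact (syzygyIncl_injective R M) (syzygyIncl_exact R M)
    (freeCover_surjective R M), projective_baseChange_syzygy M U, fun I hI =>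
    have := h3 I hI; projective_baseChange_syzygy M (R ⧸ I)⟩

theorem isRelativelyProjective_self [Module.Flat R U] [Algebra.IsEpi R U] :
    IsRelativelyProjective R U U where
  flat := inferInstance
  projective := Module.Projective.of_equiv (TensorProduct.lid' R U U).symm
  projective_quotient I hI := by
    have : Subsingleton ((R ⧸ I) ⊗[R] U) := hI
    infer_instance

variable (R U) in
/-- The modules right orthogonal to all relatively projective modules. -/
def relativelyInjective : ObjectProperty (ModuleCat.{u} R) := fun C =>
  ∀ (M : Type u) [AddCommGroup M] [Module R M], IsRelativelyProjective R U M → ExtVanishes R M C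

theorem isRightClosed_relativelyInjective : IsRightClosed (relativelyInjective R U) where
  extension S hS h1 h3 M _ _ hM := (h1 M hM).extension hS.moduleCat_injective_f
    ((ShortComplex.ShortExact.moduleCat_exact_iff_function_exact S).1 hS.exact)
    hS.moduleCat_surjective_g (h3 M hM)
  cokernel S hS h1 h2 M _ _ hM := ExtVanishes.cokernel hS.moduleCat_injective_f
    ((ShortComplex.ShortExact.moduleCat_exact_iff_function_exact S).1 hS.exact)
    hS.moduleCat_surjective_g (h1 _ hM.syzygy) (h2 M hM)
  product _ _ h M _ _ hM := ExtVanishes.pi fun i => h i M hM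
  iteratedExtension _ _ hX M _ _ hM := ExtVanishes.iteratedExtension (fun _ hN => hN M hM) hX

theorem relativelyInjective_of_basicModules (N : ModuleCat.{u} R) (hN : basicModules U N) :
    relativelyInjective R U N := by
  intro M _ _ hM
  have := hM.flat
  rcases hN with ⟨_, _⟩ | ⟨I, hI, ⟨_, _⟩⟩
  · have := hM.projective
    exact extVanishes_of_isScalarTower M U N
  · have := hM.projective_quotient I hI
    exact extVanishes_of_isScalarTower M (R ⧸ I) N

theorem isWeaklyCotorsion_of_simplyRightObtainable [Module.Flat R U] [Algebra.IsEpi R U]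
    {C : ModuleCat.{u} R} (h : SimplyRightObtainable (basicModules U) C) :
    IsWeaklyCotorsion R U C :=
  (h _ isRightClosed_relativelyInjective relativelyInjective_of_basicModules U
    isRelativelyProjective_self).subsingleton_ext

end Weak

/-! ### The Gabriel filter and its maximal ideals. -/

section Gabriel

variable {R U : Type u} [CommRing R] [CommRing U] [Algebra R U]

theorem mem_gabrielFilter_iff {I : Ideal R} :
    I ∈ gabrielFilter R U ↔ I.map (algebraMap R U) = ⊤ := by
  rw [← Ideal.Quotient.subsingleton_iff]
  exact (Algebra.TensorProduct.quotIdealMapEquivQuotTensor U I).symm.toEquiv.subsingleton_congr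

theorem gabrielFilter_of_le {I J : Ideal R} (hI : I ∈ gabrielFilter R U) (h : I ≤ J) :
    J ∈ gabrielFilter R U := by
  rw [mem_gabrielFilter_iff] at *
  exact top_unique (hI.symm.le.trans (Ideal.map_mono h))

theorem gabrielFilter_finset_inf {ι : Type*} (s : Finset ι) (f : ι → Ideal R)
    (h : ∀ i ∈ s, f i ∈ gabrielFilter R U) : s.inf f ∈ gabrielFilter R U := by
  refine gabrielFilter_of_le ?_ Ideal.prod_le_inf
  rw [mem_gabrielFilter_iff, ← Ideal.mapHom_apply, map_prod]
  exact (Finset.prod_congr rfl fun i hi => mem_gabrielFilter_iff.1 (h i hi)).trans (by simp)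

theorem gabrielFilter_iInf {ι : Type*} [Finite ι] (f : ι → Ideal R)
    (h : ∀ i, f i ∈ gabrielFilter R U) : ⨅ i, f i ∈ gabrielFilter R U := by
  have := Fintype.ofFinite ι
  rw [← Finset.inf_univ_eq_iInf]
  exact gabrielFilter_finset_inf _ _ fun i _ => h i

/-- The ideal generated by the `n`-th powers of the elements of a finite set. -/
def powSpan (t : Finset R) (n : ℕ) : Ideal R :=
  Ideal.span ((fun s => s ^ n) '' (t : Set R))

theorem pow_mem_powSpan {t : Finset R} {s : R} (hs : s ∈ t) (n : ℕ) : s ^ n ∈ powSpan t n :=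
  Ideal.subset_span ⟨s, hs, rfl⟩

theorem powSpan_mem_gabrielFilter {t : Finset R} (ht : Ideal.span (t : Set R) ∈ gabrielFilter R U)
    (n : ℕ) : powSpan t n ∈ gabrielFilter R U := by
  rw [mem_gabrielFilter_iff, Ideal.map_span] at *
  rw [powSpan, Ideal.map_span, ← Ideal.span_pow_eq_top _ ht n, Set.image_image, Set.image_image]
  simp

/-- The cyclic submodule generated by `x` is `R/Ann x`, and by flatness its tensor product with `U`
embeds in `U ⊗ N = 0`. -/
theorem torsion_mem_gabrielFilter [Module.Flat R U] {N : Type u} [AddCommGroup N] [Module R N]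
    (hN : Subsingleton (U ⊗[R] N)) (x : N) :
    LinearMap.ker (LinearMap.toSpanSingleton R N x) ∈ gabrielFilter R U := by
  let g := (LinearMap.ker (LinearMap.toSpanSingleton R N x)).liftQ
    (LinearMap.toSpanSingleton R N x) le_rfl
  have hg : Function.Injective g := by
    rw [← LinearMap.ker_eq_bot]
    exact Submodule.ker_liftQ_eq_bot _ _ _ le_rfl
  have h1 : Function.Injective (g.lTensor U) :=
    Module.Flat.lTensor_preserves_injective_linearMap g hg
  have h2 := h1.subsingleton
  exact (TensorProduct.comm R U (R ⧸ LinearMap.ker (LinearMap.toSpanSingleton R N x))).symm.toEquiv.subsingleton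

/-- The ideal of all `r` such that `r • x` comes from `R`. -/
def denominators (R : Type u) {U : Type u} [CommRing R] [CommRing U] [Algebra R U] (x : U) :
    Ideal R :=
  (LinearMap.range (Algebra.linearMap R U)).comap (LinearMap.toSpanSingleton R U x)

theorem mem_denominators {x : U} {r : R} :
    r ∈ denominators R x ↔ ∃ a : R, algebraMap R U a = r • x := by
  simp [denominators]

theorem denominators_mem_gabrielFilter [Module.Flat R U] [Algebra.IsEpi R U] (x : U) :
    denominators R x ∈ gabrielFilter R U := by
  have hs : Subsingleton (U ⊗[R] (U ⧸ LinearMap.range (Algebra.linearMap R U))) := by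
    refine subsingleton_of_forall_eq 0 fun z => ?_
    induction z with
    | zero => rfl
    | add x y hx hy => rw [hx, hy, add_zero]
    | tmul a b =>
      obtain ⟨b, rfl⟩ := Submodule.Quotient.mk_surjective _ b
      -- The epimorphism property is `1 ⊗ b = b ⊗ 1`; it moves `b` to the left factor, leaving `1`,
      -- which dies in `U/R`.
      have h : a ⊗ₜ[R] b = (a * b) ⊗ₜ[R] (1 : U) := by
        have h1 := (Algebra.isEpi_iff_forall_one_tmul_eq R U).1 inferInstance b
        have h2 := congrArg (fun w => (a ⊗ₜ[R] (1 : U)) * w) h1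
        simpa using h2
      have h3 := congrArg ((Submodule.mkQ (LinearMap.range (Algebra.linearMap R U))).lTensor U) h
      rw [LinearMap.lTensor_tmul, LinearMap.lTensor_tmul] at h3
      have h4 : Submodule.mkQ (LinearMap.range (Algebra.linearMap R U)) 1 = 0 := by
        rw [Submodule.mkQ_apply, Submodule.Quotient.mk_eq_zero]
        exact ⟨1, by simp⟩
      rw [h4, TensorProduct.tmul_zero] at h3
      exact h3
  refine gabrielFilter_of_le (torsion_mem_gabrielFilter hs (Submodule.Quotient.mk x)) ?_
  intro r hr
  rw [LinearMap.mem_ker, LinearMap.toSpanSingleton_apply, ← Submodule.Quotient.mk_smul,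
    Submodule.Quotient.mk_eq_zero] at hr
  exact hr

/-- The annihilator of an element of `R`. -/
def annihilatorIdeal (t : R) : Ideal R := LinearMap.ker (LinearMap.toSpanSingleton R R t)

theorem mem_annihilatorIdeal {t r : R} : r ∈ annihilatorIdeal t ↔ r * t = 0 := by
  simp [annihilatorIdeal]

theorem annihilatorIdeal_mem_gabrielFilter [Module.Flat R U] {t : R} (ht : algebraMap R U t = 0) :
    annihilatorIdeal t ∈ gabrielFilter R U := by
  let T := LinearMap.ker (Algebra.linearMap R U)
  have hs : Subsingleton (U ⊗[R] T) := by
    have hinj : Function.Injective (TensorProduct.rid R U ∘ T.subtype.lTensor U) :=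
      (TensorProduct.rid R U).injective.comp
        (Module.Flat.lTensor_preserves_injective_linearMap _ T.injective_subtype)
    have hz : ∀ z, TensorProduct.rid R U (T.subtype.lTensor U z) = 0 := by
      intro z
      induction z with
      | zero => simp
      | add x y hx hy => rw [map_add, map_add, hx, hy, add_zero]
      | tmul a b =>
        have : algebraMap R U b = 0 := b.2
        simp [Algebra.smul_def, this]
    exact ⟨fun x y => hinj ((hz x).trans (hz y).symm)⟩
  refine gabrielFilter_of_le (torsion_mem_gabrielFilter hs ⟨t, ht⟩) ?_
  intro r hr
  exact congrArg Subtype.val (LinearMap.mem_ker.1 hr)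

theorem finite_maximal_above {J : Ideal R} (h : IsSemilocal (R ⧸ J)) :
    {n : Ideal R | n.IsMaximal ∧ J ≤ n}.Finite := by
  refine (h.image (Ideal.comap (Ideal.Quotient.mk J))).subset ?_
  rintro n ⟨hn, hJ⟩
  have hc : Ideal.comap (Ideal.Quotient.mk J) (Ideal.map (Ideal.Quotient.mk J) n) = n := by
    rw [Ideal.comap_map_of_surjective _ Ideal.Quotient.mk_surjective, ← RingHom.ker_eq_comap_bot,
      Ideal.mk_ker, sup_eq_left.2 hJ]
  refine ⟨_, ?_, hc⟩
  refine (Ideal.map_eq_top_or_isMaximal_of_surjective _ Ideal.Quotient.mk_surjective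
    hn).resolve_left fun h => hn.ne_top ?_
  rw [← hc, h, Ideal.comap_top]

theorem isMaximal_of_isPrime_above {J : Ideal R} (h : HasKrullDimZero (R ⧸ J)) {p : Ideal R}
    (hp : p.IsPrime) (hJ : J ≤ p) : p.IsMaximal := by
  have hc : Ideal.comap (Ideal.Quotient.mk J) (Ideal.map (Ideal.Quotient.mk J) p) = p := by
    rw [Ideal.comap_map_of_surjective _ Ideal.Quotient.mk_surjective, ← RingHom.ker_eq_comap_bot,
      Ideal.mk_ker, sup_eq_left.2 hJ]
  have := h _ (Ideal.map_isPrime_of_surjective Ideal.Quotient.mk_surjective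
    (by rwa [Ideal.mk_ker]) (I := p))
  rw [← hc]
  exact Ideal.comap_isMaximal_of_surjective _ Ideal.Quotient.mk_surjective

/-- `t` is a finite set generating an ideal of the Gabriel filter whose only maximal ideal
above is `m`. -/
structure IsLocalGenerators (U : Type u) [CommRing U] [Algebra R U] (m : Ideal R) (t : Finset R) :
    Prop where
  mem : ∀ s ∈ t, s ∈ m
  span_mem : Ideal.span (t : Set R) ∈ gabrielFilter R U
  eq : ∀ n : Ideal R, n.IsMaximal → (∀ s ∈ t, s ∈ n) → n = m

/-- The equation `1 ∈ mU` involves finitely many elements of `m`. Only finitely many maximal ideals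
lie above them, and each one other than `m` is excluded by adding one element of `m` outside it. -/
theorem exists_isLocalGenerators (hnil : IsHNil (gabrielFilter R U)) {m : Ideal R}
    (hm : m.IsMaximal) (hmG : m ∈ gabrielFilter R U) : ∃ t, IsLocalGenerators U m t := by
  classical
  have h1 : ∃ t₀ : Finset R, (∀ s ∈ t₀, s ∈ m) ∧ Ideal.span (t₀ : Set R) ∈ gabrielFilter R U := by
    have h := mem_gabrielFilter_iff.1 hmG
    rw [Ideal.eq_top_iff_one, Ideal.map] at h
    obtain ⟨t', ht', h'⟩ := Submodule.mem_span_finite_of_mem_span h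
    obtain ⟨t₀, ht₀, rfl⟩ := Finset.subset_set_image_iff.1 ht'
    refine ⟨t₀, fun s hs => ht₀ hs, ?_⟩
    rw [mem_gabrielFilter_iff, Ideal.map_span, Ideal.eq_top_iff_one]
    rwa [Finset.coe_image] at h'
  obtain ⟨t₀, ht₀, hG⟩ := h1
  have hfin := finite_maximal_above (hnil _ hG).1
  have hx : ∀ n : Ideal R, ∃ x ∈ m, n.IsMaximal → n ≠ m → x ∉ n := by
    intro n
    by_cases h : m ≤ n
    · exact ⟨0, m.zero_mem, fun hn hne => absurd (hm.eq_of_le hn.ne_top h).symm hne⟩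
    · obtain ⟨x, hxm, hxn⟩ := SetLike.not_le_iff_exists.1 h
      exact ⟨x, hxm, fun _ _ => hxn⟩
  choose x hxm hxn using hx
  refine ⟨t₀ ∪ hfin.toFinset.image x, fun s hs => ?_, ?_, fun n hn hs => ?_⟩
  · rcases Finset.mem_union.1 hs with h | h
    · exact ht₀ s h
    · obtain ⟨n, -, rfl⟩ := Finset.mem_image.1 h
      exact hxm n
  · exact gabrielFilter_of_le hG (Ideal.span_mono (by simp))
  · by_contra hne
    refine hxn n hn hne (hs _ (Finset.mem_union_right _ (Finset.mem_image_of_mem _ ?_)))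
    rw [Set.Finite.mem_toFinset]
    exact ⟨hn, Ideal.span_le.2 fun s h => hs s (Finset.mem_union_left _ h)⟩

theorem IsLocalGenerators.eq_of_powSpan_le {m : Ideal R} {t : Finset R}
    (h : IsLocalGenerators U m t) {n : Ideal R} (hn : n.IsMaximal) {k : ℕ}
    (hle : powSpan t k ≤ n) : n = m :=
  h.eq n hn fun _ hs => hn.isPrime.mem_of_pow_mem k (hle (pow_mem_powSpan hs k))

/-- The form in which h-nilness is used: locally at `m`, every `J ∈ 𝔾` contains a power of each
generator, and `e`, a unit modulo `powSpan t N`, does the localizing. -/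
theorem IsLocalGenerators.exists_localizer (hnil : IsHNil (gabrielFilter R U)) {m : Ideal R}
    (hm : m.IsMaximal) {t : Finset R} (h : IsLocalGenerators U m t) {J : Ideal R}
    (hJ : J ∈ gabrielFilter R U) (N : ℕ) :
    ∃ (e : R) (k : ℕ), 1 - e ∈ powSpan t N ∧ ∀ s ∈ t, e * s ^ k ∈ J := by
  classical
  obtain ⟨h1, h2⟩ := hnil J hJ
  have hfin := finite_maximal_above h1
  -- An element of all maximal ideals above `J` except possibly `m`. As primes above `J` are
  -- maximal, `e₀ * s` lies in every one of them, hence in the radical of `J`.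
  obtain ⟨e₀, he₀, hem⟩ : ∃ e₀ ∈ (hfin.toFinset.erase m).inf id, e₀ ∉ m := by
    refine SetLike.not_le_iff_exists.1 fun hle => ?_
    obtain ⟨n, hn, hnm⟩ := hm.isPrime.inf_le'.1 hle
    rw [Finset.mem_erase, Set.Finite.mem_toFinset] at hn
    exact hn.1 (hn.2.1.eq_of_le hm.ne_top hnm)
  have hrad : ∀ s ∈ t, e₀ * s ∈ J.radical := by
    intro s hs
    rw [Ideal.radical_eq_sInf, Ideal.mem_sInf]
    rintro p ⟨hJp, hp⟩
    by_cases hpm : p = m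
    · exact hpm ▸ m.mul_mem_left _ (h.mem s hs)
    · refine p.mul_mem_right _ ((Finset.inf_le (f := id) ?_ : _ ≤ id p) he₀)
      rw [Finset.mem_erase, Set.Finite.mem_toFinset]
      exact ⟨hpm, isMaximal_of_isPrime_above h2 hp hJp, hJp⟩
  choose! k hk using hrad
  let K := t.sup k
  have hK : ∀ s ∈ t, e₀ ^ K * s ^ K ∈ J := fun s hs => by
    rw [← mul_pow]
    exact J.pow_mem_of_pow_mem (hk s hs) (Finset.le_sup hs)
  have htop : Ideal.span {e₀ ^ K} ⊔ powSpan t N = ⊤ := by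
    by_contra hne
    obtain ⟨n, hn, hle⟩ := Ideal.exists_le_maximal _ hne
    obtain rfl := h.eq_of_powSpan_le hn (le_sup_right.trans hle)
    exact hem (hn.isPrime.mem_of_pow_mem K
      (hle (Ideal.mem_sup_left (Ideal.mem_span_singleton_self _))))
  obtain ⟨y, hy, z, hz, hyz⟩ := Submodule.mem_sup.1 ((Ideal.eq_top_iff_one _).1 htop)
  obtain ⟨a, rfl⟩ := Ideal.mem_span_singleton'.1 hy
  refine ⟨a * e₀ ^ K, K, ?_, fun s hs => ?_⟩
  · rwa [← hyz, add_sub_cancel_left]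
  · rw [mul_assoc]
    exact J.mul_mem_left _ (hK s hs)

end Gabriel

/-! ### Modules of fractions and the telescope presentation of `U`. -/

section Fractions

variable {R : Type u} [CommRing R] (U : Type u) [CommRing U] [Algebra R U]

/-- The submodule of elements of `U` together with compatible numerators with respect to the denominators `s ^ n`,
`s ∈ t`. -/
def fractionSubmodule (t : Finset R) (n : ℕ) : Submodule R (U × (t → R)) where
  carrier := {x | (∀ i, algebraMap R U (x.2 i) = i.1 ^ n • x.1) ∧
    ∀ i j, i.1 ^ n * x.2 j = j.1 ^ n * x.2 i}
  zero_mem' := by simp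
  add_mem' := by
    rintro x y ⟨h1, h2⟩ ⟨h3, h4⟩
    exact ⟨fun i => by simp [h1, h3], fun i j => by
      simp only [Prod.snd_add, Pi.add_apply, mul_add, h2 i j, h4 i j]⟩
  smul_mem' := by
    rintro r x ⟨h1, h2⟩
    refine ⟨fun i => ?_, fun i j => ?_⟩
    · simp only [Prod.smul_snd, Pi.smul_apply, Prod.smul_fst, smul_eq_mul, map_mul, h1]
      rw [smul_comm, Algebra.smul_def r]
    · simp only [Prod.smul_snd, Pi.smul_apply, smul_eq_mul]
      rw [mul_left_comm, h2 i j, mul_left_comm]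

/-- The module of elements of `U` together with compatible numerators with respect to the
denominators `s ^ n`, `s ∈ t`. -/
def Fractions (t : Finset R) (n : ℕ) : Type u := fractionSubmodule U t n

instance (t : Finset R) (n : ℕ) : AddCommGroup (Fractions U t n) :=
  inferInstanceAs (AddCommGroup (fractionSubmodule U t n))

instance (t : Finset R) (n : ℕ) : Module R (Fractions U t n) :=
  inferInstanceAs (Module R (fractionSubmodule U t n))

namespace Fractions

variable {U} {t : Finset R} {n k : ℕ}

variable (U t n) in
/-- The value in `U`. -/
def val : Fractions U t n →ₗ[R] U :=
  LinearMap.fst R U (t → R) ∘ₗ (fractionSubmodule U t n).subtype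

variable (U n) in
/-- The numerators. -/
def coord (i : t) : Fractions U t n →ₗ[R] R :=
  LinearMap.proj i ∘ₗ LinearMap.snd R U (t → R) ∘ₗ (fractionSubmodule U t n).subtype

theorem ext {x y : Fractions U t n} (h1 : val U t n x = val U t n y)
    (h2 : ∀ i, coord U n i x = coord U n i y) : x = y := Subtype.ext (Prod.ext h1 (funext h2))

theorem algebraMap_coord (i : t) (x) : algebraMap R U (coord U n i x) = i.1 ^ n • val U t n x :=
  x.2.1 i

theorem pow_mul_coord (i j : t) (x : Fractions U t n) :
    i.1 ^ n * coord U n j x = j.1 ^ n * coord U n i x :=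
  x.2.2 i j

/-- Build a linear map to fractions from its value and numerators. -/
def lift {N : Type*} [AddCommGroup N] [Module R N] (v : N →ₗ[R] U) (c : t → N →ₗ[R] R)
    (h1 : ∀ i x, algebraMap R U (c i x) = i.1 ^ n • v x)
    (h2 : ∀ i j x, i.1 ^ n * c j x = j.1 ^ n * c i x) : N →ₗ[R] Fractions U t n :=
  LinearMap.codRestrict (fractionSubmodule U t n) (v.prod (LinearMap.pi c)) fun x =>
    ⟨fun i => h1 i x, fun i j => h2 i j x⟩

variable (U t n) in
/-- The inclusion of the fractions with denominator one. -/
def unit : R →ₗ[R] Fractions U t n :=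
  lift (Algebra.linearMap R U) (fun i => LinearMap.mulLeft R (i.1 ^ n))
    (fun i x => by simp [Algebra.smul_def]) fun i j x => by simp; ring

variable (U t) in
/-- Passage to a larger denominator. -/
def shift (h : n ≤ k) : Fractions U t n →ₗ[R] Fractions U t k :=
  lift (val U t n) (fun i => LinearMap.mulLeft R (i.1 ^ (k - n)) ∘ₗ coord U n i)
    (fun i x => by
      rw [LinearMap.comp_apply, LinearMap.mulLeft_apply, map_mul, algebraMap_coord,
        ← Algebra.smul_def, smul_smul, pow_sub_mul_pow _ h]) fun i j x => by
      rw [LinearMap.comp_apply, LinearMap.comp_apply, LinearMap.mulLeft_apply,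
        LinearMap.mulLeft_apply, ← pow_sub_mul_pow i.1 h, ← pow_sub_mul_pow j.1 h]
      linear_combination (i.1 ^ (k - n) * j.1 ^ (k - n)) * pow_mul_coord i j x

@[simp] theorem val_unit (r : R) : val U t n (unit U t n r) = algebraMap R U r := rfl

@[simp] theorem coord_unit (i : t) (r : R) : coord U n i (unit U t n r) = i.1 ^ n * r := rfl

@[simp] theorem val_shift (h : n ≤ k) (x) : val U t k (shift U t h x) = val U t n x := rfl

@[simp] theorem coord_shift (h : n ≤ k) (i : t) (x) :
    coord U k i (shift U t h x) = i.1 ^ (k - n) * coord U n i x := rfl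

theorem shift_unit (h : n ≤ k) (r : R) : shift U t h (unit U t n r) = unit U t k r :=
  ext rfl fun i => by simp [← mul_assoc, pow_sub_mul_pow _ h]

/-- Compatibility of the numerators says exactly this: the fractions modulo the image of `R` are
killed by every `s ^ n`, even when `R → U` has a kernel. -/
theorem pow_smul_eq (i : t) (x : Fractions U t n) :
    i.1 ^ n • x = unit U t n (coord U n i x) :=
  ext (by rw [map_smul, val_unit, algebraMap_coord]) fun j => by
    rw [map_smul, coord_unit, smul_eq_mul]
    exact pow_mul_coord i j x

end Fractions

variable (R) in
/-- The maximal ideals belonging to the Gabriel filter. -/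
abbrev GabrielMax : Type u := {m : Ideal R // m.IsMaximal ∧ m ∈ gabrielFilter R U}

variable {U} (t : GabrielMax R U → Finset R)

/-- The direct sum of all modules of fractions. -/
abbrev FracSum : Type u := DirectSum (GabrielMax R U × ℕ) fun i => Fractions U (t i.1) i.2

open Classical in
/-- The canonical map from the direct sum of fractions to `U`. -/
noncomputable def toTarget : R × FracSum t →ₗ[R] U :=
  (Algebra.linearMap R U).coprod
    (DirectSum.toModule R _ U fun i => Fractions.val U (t i.1) i.2)

open Classical in
/-- The inclusion of a summand. -/
noncomputable def fracIncl (i : GabrielMax R U × ℕ) : Fractions U (t i.1) i.2 →ₗ[R] FracSum t :=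
  DirectSum.lof R _ (fun i : GabrielMax R U × ℕ => Fractions U (t i.1) i.2) i

open Classical in
/-- The telescope map. -/
noncomputable def telescope : FracSum t →ₗ[R] FracSum t :=
  DirectSum.toModule R _ _ fun i =>
    fracIncl t i - fracIncl t (i.1, i.2 + 1) ∘ₗ Fractions.shift U (t i.1) (Nat.le_succ i.2)

/-- The presentation of `U` by modules of fractions. -/
noncomputable def relations : (GabrielMax R U →₀ R) × FracSum t →ₗ[R] R × FracSum t :=
  (Finsupp.lsum R fun m => LinearMap.prod LinearMap.id
    (-(fracIncl t (m, 0) ∘ₗ Fractions.unit U (t m) 0))).coprod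
  (LinearMap.prod 0 (telescope t))

theorem toTarget_inl (r : R) : toTarget t (r, 0) = algebraMap R U r := by simp [toTarget]

theorem toTarget_fracIncl (i) (x) : toTarget t (0, fracIncl t i x) =
    Fractions.val U (t i.1) i.2 x := by
  classical
  simp [toTarget, fracIncl]

theorem telescope_fracIncl (i) (x) : telescope t (fracIncl t i x) = fracIncl t i x -
    fracIncl t (i.1, i.2 + 1) (Fractions.shift U (t i.1) (Nat.le_succ i.2) x) := by
  classical
  simp only [telescope]
  rw [fracIncl, DirectSum.toModule_lof]
  rfl

theorem FracSum.hom_ext {N : Type*} [AddCommGroup N] [Module R N] {f g : FracSum t →ₗ[R] N}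
    (h : ∀ i x, f (fracIncl t i x) = g (fracIncl t i x)) : f = g := by
  classical
  exact DirectSum.linearMap_ext R fun i => LinearMap.ext (h i)

theorem toTarget_relations (x) : toTarget t (relations t x) = 0 := by
  have h : toTarget t ∘ₗ relations t = 0 := by
    refine LinearMap.prod_ext (Finsupp.lhom_ext fun m r => ?_) (FracSum.hom_ext t fun i x => ?_)
    · have : relations t (Finsupp.single m r, 0) =
          (r, 0) - (0, fracIncl t (m, 0) (Fractions.unit U (t m) 0 r)) := by
        simp [relations]
      rw [LinearMap.comp_apply, LinearMap.comp_apply, LinearMap.inl_apply, LinearMap.comp_apply,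
        this, map_sub, toTarget_inl, toTarget_fracIncl]
      simp
    · have : relations t (0, fracIncl t i x) = (0, fracIncl t i x) -
          (0, fracIncl t (i.1, i.2 + 1) (Fractions.shift U (t i.1) (Nat.le_succ i.2) x)) := by
        simp [relations, telescope_fracIncl]
      rw [LinearMap.comp_apply, LinearMap.inr_apply, LinearMap.comp_apply, this, map_sub,
        toTarget_fracIncl, toTarget_fracIncl]
      simp
  exact LinearMap.congr_fun h x

theorem telescope_apply_zero (g : FracSum t) (m) : telescope t g (m, 0) = g (m, 0) := by
  classical
  suffices h : DirectSum.component R _ _ (m, 0) ∘ₗ telescope t =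
      DirectSum.component R _ (fun i : GabrielMax R U × ℕ => Fractions U (t i.1) i.2) (m, 0) from
    LinearMap.congr_fun h g
  refine FracSum.hom_ext t fun i x => ?_
  rw [LinearMap.comp_apply, telescope_fracIncl, map_sub, sub_eq_self]
  exact DirectSum.of_eq_of_ne _ _ _ (by simp)

theorem telescope_apply_succ (g : FracSum t) (m) (n : ℕ) : telescope t g (m, n + 1) =
    g (m, n + 1) - Fractions.shift U (t m) (Nat.le_succ n) (g (m, n)) := by
  classical
  suffices h : DirectSum.component R _ _ (m, n + 1) ∘ₗ telescope t =
      DirectSum.component R _ (fun i : GabrielMax R U × ℕ => Fractions U (t i.1) i.2) (m, n + 1) -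
      Fractions.shift U (t m) (Nat.le_succ n) ∘ₗ DirectSum.component R _
        (fun i : GabrielMax R U × ℕ => Fractions U (t i.1) i.2) (m, n) from
    LinearMap.congr_fun h g
  refine FracSum.hom_ext t fun i x => ?_
  rw [LinearMap.comp_apply, telescope_fracIncl, map_sub, LinearMap.sub_apply, LinearMap.comp_apply]
  congr 1
  by_cases h : i = (m, n)
  · subst h
    simp only [fracIncl]
    erw [DirectSum.component.lof_self, DirectSum.component.lof_self]
  · have h1 : DirectSum.component R _ (fun i : GabrielMax R U × ℕ => Fractions U (t i.1) i.2)
        (m, n) (fracIncl t i x) = 0 := DirectSum.of_eq_of_ne _ _ _ (Ne.symm h)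
    rw [h1, map_zero]
    refine DirectSum.of_eq_of_ne _ _ _ fun h' => h ?_
    have h2 := congrArg Prod.fst h'
    have h3 := congrArg Prod.snd h'
    simp only [Nat.add_right_cancel_iff] at h2 h3
    exact Prod.ext h2.symm h3.symm

end Fractions

/-! ### Exactness of the presentation, checked at each maximal ideal. -/

section Exactness

variable {R : Type u} [CommRing R] {U : Type u} [CommRing U] [Algebra R U]
  {t : GabrielMax R U → Finset R}

theorem IsLocalGenerators.not_mem_of_one_sub_mem {m : Ideal R} {t : Finset R}
    (h : IsLocalGenerators U m t) (hm : m.IsMaximal) {e : R} (he : 1 - e ∈ powSpan t 1) :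
    e ∉ m := by
  intro hem
  have h1 : powSpan t 1 ≤ m := by
    rw [powSpan, Ideal.span_le]
    rintro _ ⟨s, hs, rfl⟩
    simpa using h.mem s hs
  exact hm.ne_top ((Ideal.eq_top_iff_one _).2 (by simpa using m.add_mem (h1 he) hem))

theorem IsLocalGenerators.exists_pow_not_mem {m n : Ideal R} {t : Finset R}
    (h : IsLocalGenerators U m t) (hn : n.IsMaximal) (hne : n ≠ m) (k : ℕ) :
    ∃ s ∈ t, s ^ k ∉ n := by
  by_contra hc
  push Not at hc
  exact hne (h.eq n hn fun s hs => hn.isPrime.mem_of_pow_mem k (hc s hs))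

theorem Ideal.eq_top_of_forall_isMaximal {I : Ideal R}
    (h : ∀ n : Ideal R, n.IsMaximal → ∃ e ∈ I, e ∉ n) : I = ⊤ := by
  by_contra hne
  obtain ⟨n, hn, hle⟩ := Ideal.exists_le_maximal _ hne
  obtain ⟨e, he, hen⟩ := h n hn
  exact hen (hle he)

theorem toTarget_surjective [Module.Flat R U] [Algebra.IsEpi R U]
    (hnil : IsHNil (gabrielFilter R U)) (ht : ∀ m, IsLocalGenerators U m.1 (t m)) :
    Function.Surjective (toTarget t) := by
  intro u
  have hR : ∀ r, algebraMap R U r ∈ LinearMap.range (toTarget t) := fun r =>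
    ⟨_, toTarget_inl t r⟩
  suffices h : (LinearMap.range (toTarget t)).comap (LinearMap.toSpanSingleton R U u) = ⊤ by
    have h1 : (1 : R) ∈ (LinearMap.range (toTarget t)).comap (LinearMap.toSpanSingleton R U u) := by
      rw [h]; trivial
    simpa using h1
  refine Ideal.eq_top_of_forall_isMaximal fun n hn => ?_
  by_cases hnG : n ∈ gabrielFilter R U
  swap
  · have : ¬ denominators R u ≤ n := fun h =>
      hnG (gabrielFilter_of_le (denominators_mem_gabrielFilter u) h)
    obtain ⟨e, he, hen⟩ := SetLike.not_le_iff_exists.1 this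
    refine ⟨e, ?_, hen⟩
    obtain ⟨a, ha⟩ := mem_denominators.1 he
    rw [Submodule.mem_comap, LinearMap.toSpanSingleton_apply, ← ha]
    exact hR a
  let m : GabrielMax R U := ⟨n, hn, hnG⟩
  obtain ⟨e, k, he, hek⟩ := (ht m).exists_localizer hnil hn (denominators_mem_gabrielFilter u) 1
  choose r hr using fun i : t m => mem_denominators.1 (hek i.1 i.2)
  have hT : ∀ p : t m × t m, algebraMap R U (p.1.1 ^ k * r p.2 - p.2.1 ^ k * r p.1) = 0 := by
    intro p
    simp only [map_sub, map_mul, hr, Algebra.smul_def]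
    ring
  -- The numerators `r` are compatible only up to elements dying in `U`; a second localizer kills
  -- these errors at the cost of raising the exponent by `k'`.
  obtain ⟨e', k', he', hek'⟩ := (ht m).exists_localizer hnil hn
    (gabrielFilter_iInf _ fun p => annihilatorIdeal_mem_gabrielFilter (hT p)) 1
  have hkill : ∀ i j l : t m, (e' * l.1 ^ k') * (i.1 ^ k * r j - j.1 ^ k * r i) = 0 := by
    intro i j l
    have := (Ideal.mem_iInf.1 (hek' l.1 l.2)) (i, j)
    exact mem_annihilatorIdeal.1 this
  refine ⟨e' * e, ?_, fun h => (hn.isPrime.mem_or_mem h).elim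
    ((ht m).not_mem_of_one_sub_mem hn he') ((ht m).not_mem_of_one_sub_mem hn he)⟩
  let x : Fractions U (t m) (k + k') := ⟨((e' * e) • u, fun i => i.1 ^ k' * (e' * r i)),
    fun i => by
      simp only [map_mul, hr, Algebra.smul_def, map_pow]
      ring, fun i j => by
      simp only
      linear_combination (j.1 ^ k') * hkill i j i⟩
  exact ⟨(0, fracIncl t (m, k + k') x), toTarget_fracIncl t (m, k + k') x⟩

/-- The telescope forces `g (m, n)` to be the image of `a m` for every `n`. As `g` has finite
support, `a m` is killed by powers of the generators, so it vanishes locally away from `m`; at `m`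
it is minus a sum of other `a m'`, which vanish there. -/
theorem relations_injective (ht : ∀ m, IsLocalGenerators U m.1 (t m)) :
    Function.Injective (relations t) := by
  classical
  rw [← LinearMap.ker_eq_bot, LinearMap.ker_eq_bot']
  rintro ⟨a, g⟩ h0
  have hsum : a.sum (fun _ r => r) = 0 := by
    have := congrArg Prod.fst h0
    simpa [relations, Finsupp.sum, Prod.fst_sum] using this
  have hsnd : telescope t g - a.sum (fun m r => fracIncl t (m, 0) (Fractions.unit U (t m) 0 r)) =
      0 := by
    have := congrArg Prod.snd h0
    refine Eq.trans ?_ this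
    simp [relations, Finsupp.sum, Prod.snd_sum]
    abel
  have hcomp : ∀ m n, (a.sum (fun m r => fracIncl t (m, 0) (Fractions.unit U (t m) 0 r)) :
      FracSum t) (m, n + 1) = 0 := by
    intro m n
    rw [Finsupp.sum, DFinsupp.finsetSum_apply]
    exact Finset.sum_eq_zero fun m' _ => DirectSum.of_eq_of_ne _ _ _ (by simp)
  have hcomp0 : ∀ m, (a.sum (fun m r => fracIncl t (m, 0) (Fractions.unit U (t m) 0 r)) :
      FracSum t) (m, 0) = Fractions.unit U (t m) 0 (a m) := by
    intro m
    rw [Finsupp.sum, DFinsupp.finsetSum_apply, Finset.sum_eq_single m]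
    · exact DirectSum.of_eq_same _ _
    · intro m' _ hne
      exact DirectSum.of_eq_of_ne _ _ _ (by simp [hne.symm])
    · intro hm
      rw [Finsupp.notMem_support_iff.1 hm]
      simp
  have hg : ∀ m n, g (m, n) = Fractions.unit U (t m) n (a m) := by
    intro m n
    induction n with
    | zero => rw [← hcomp0, ← sub_eq_zero.1 hsnd, telescope_apply_zero]
    | succ n ih =>
      have h1 := telescope_apply_succ t g m n
      rw [sub_eq_zero.1 hsnd, hcomp, ih, Fractions.shift_unit] at h1
      exact (sub_eq_zero.1 h1.symm)
  have hpow : ∀ m, ∃ n, ∀ i : t m, i.1 ^ n * a m = 0 := by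
    intro m
    have hfin : (Set.range (fun n : ℕ => (m, n)) \ (DFinsupp.support g : Set _)).Nonempty := by
      refine (Set.Infinite.sdiff (Set.infinite_range_of_injective fun _ _ h => ?_)
        (Finset.finite_toSet _)).nonempty
      exact (Prod.ext_iff.1 h).2
    obtain ⟨_, ⟨n, rfl⟩, hn⟩ := hfin
    have hz : g (m, n) = 0 := by simpa using hn
    rw [hg] at hz
    exact ⟨n, fun i => by rw [← Fractions.coord_unit (U := U), hz, map_zero]⟩
  choose N hN using hpow
  have ha : ∀ m, a m = 0 := by
    intro m
    suffices h : annihilatorIdeal (a m) = ⊤ by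
      have : (1 : R) ∈ annihilatorIdeal (a m) := by rw [h]; trivial
      simpa using mem_annihilatorIdeal.1 this
    refine Ideal.eq_top_of_forall_isMaximal fun n hn => ?_
    by_cases hnm : n = m.1
    swap
    · obtain ⟨s, hs, hsn⟩ := (ht m).exists_pow_not_mem hn hnm (N m)
      exact ⟨_, mem_annihilatorIdeal.2 (hN m ⟨s, hs⟩), hsn⟩
    have hex : ∀ m', ∃ b, m' ≠ m → b ∉ n ∧ b * a m' = 0 := by
      intro m'
      by_cases h : m' = m
      · exact ⟨0, fun h' => absurd h h'⟩
      · obtain ⟨s, hs, hsn⟩ := (ht m').exists_pow_not_mem hn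
          (fun h' => h (Subtype.ext (h'.symm.trans hnm))) (N m')
        exact ⟨_, fun _ => ⟨hsn, hN m' ⟨s, hs⟩⟩⟩
    choose b hb using hex
    refine ⟨∏ m' ∈ a.support.erase m, b m', ?_, fun hmem => ?_⟩
    · rw [mem_annihilatorIdeal]
      by_cases hm : m ∈ a.support
      swap
      · rw [Finsupp.notMem_support_iff.1 hm, mul_zero]
      rw [Finsupp.sum, ← Finset.add_sum_erase _ _ hm] at hsum
      rw [eq_neg_of_add_eq_zero_left hsum, mul_neg, Finset.mul_sum, neg_eq_zero]
      refine Finset.sum_eq_zero fun m' hm' => ?_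
      rw [← Finset.prod_erase_mul _ _ hm', mul_assoc, (hb m' (Finset.ne_of_mem_erase hm')).2,
        mul_zero]
    · obtain ⟨m', hm', hmem'⟩ := hn.isPrime.prod_mem_iff.1 hmem
      exact (hb m' (Finset.ne_of_mem_erase hm')).1 hmem'
  refine Prod.ext (Finsupp.ext ha) (DFinsupp.ext fun i => ?_)
  rw [← Prod.mk.eta (p := i), hg, ha, map_zero]
  rfl

variable (t) in
/-- The image of an element of `R` in the module presented by `relations`. -/
noncomputable def presOne : R →ₗ[R] (R × FracSum t) ⧸ LinearMap.range (relations t) :=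
  Submodule.mkQ _ ∘ₗ LinearMap.inl R R (FracSum t)

variable (t) in
/-- The image of a fraction in the module presented by `relations`. -/
noncomputable def presFrac (m : GabrielMax R U) (n : ℕ) :
    Fractions U (t m) n →ₗ[R] (R × FracSum t) ⧸ LinearMap.range (relations t) :=
  Submodule.mkQ _ ∘ₗ LinearMap.inr R R (FracSum t) ∘ₗ fracIncl t (m, n)

theorem presFrac_shift_succ (m n x) :
    presFrac t m (n + 1) (Fractions.shift U (t m) (Nat.le_succ n) x) = presFrac t m n x := by
  refine ((Submodule.Quotient.eq (LinearMap.range (relations t))).2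
    (LinearMap.mem_range.2 ⟨(0, fracIncl t (m, n) x), ?_⟩)).symm
  simp [relations]
  exact telescope_fracIncl t (m, n) x

theorem presFrac_shift {m : GabrielMax R U} {n k : ℕ} (h : n ≤ k) (x) :
    presFrac t m k (Fractions.shift U (t m) h x) = presFrac t m n x := by
  induction k, h using Nat.le_induction with
  | base => congr 1; exact Fractions.ext rfl fun i => by simp
  | succ k hk ih =>
    rw [← ih, ← presFrac_shift_succ m k]
    congr 1
    exact Fractions.ext rfl fun i => by
      rw [Fractions.coord_shift, Fractions.coord_shift, Fractions.coord_shift, ← mul_assoc,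
        ← pow_add]
      congr 2
      omega

theorem presFrac_unit (m : GabrielMax R U) (n : ℕ) (r : R) :
    presFrac t m n (Fractions.unit U (t m) n r) = presOne t r := by
  rw [← Fractions.shift_unit (Nat.zero_le n), presFrac_shift]
  refine ((Submodule.Quotient.eq (LinearMap.range (relations t))).2
    (LinearMap.mem_range.2 ⟨(Finsupp.single m r, 0), ?_⟩)).symm
  simp [relations]

theorem pres_induction {Q : (R × FracSum t) ⧸ LinearMap.range (relations t) → Prop}
    (h1 : ∀ r, Q (presOne t r)) (h2 : ∀ m n x, Q (presFrac t m n x))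
    (h3 : ∀ x y, Q x → Q y → Q (x + y)) (x) : Q x := by
  classical
  obtain ⟨⟨r, g⟩, rfl⟩ := Submodule.Quotient.mk_surjective _ x
  have : (Submodule.Quotient.mk (r, g) : (R × FracSum t) ⧸ LinearMap.range (relations t)) =
      presOne t r + Submodule.mkQ _ (LinearMap.inr R R (FracSum t) g) := by
    rw [presOne, LinearMap.comp_apply, ← map_add]
    simp
  rw [this]
  refine h3 _ _ (h1 r) ?_
  clear this
  induction g using DirectSum.induction_on with
  | zero => rw [map_zero, map_zero, ← map_zero (presOne t)]; exact h1 0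
  | of i x => exact h2 i.1 i.2 x
  | add x y hx hy =>
    rw [map_add, map_add]
    exact h3 _ _ hx hy

/-- The annihilator of `r` is in `𝔾`. At `n ∉ 𝔾` some element of it is a local unit; at `n ∈ 𝔾` a
localizer `e` makes all numerators `s ^ k * (e * r)` vanish, so `e * r` is zero as a fraction. -/
theorem presOne_eq_zero [Module.Flat R U] (hnil : IsHNil (gabrielFilter R U))
    (ht : ∀ m, IsLocalGenerators U m.1 (t m)) {r : R} (hr : algebraMap R U r = 0) :
    presOne t r = 0 := by
  suffices h : LinearMap.ker (LinearMap.toSpanSingleton R _ (presOne t r)) = ⊤ by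
    have : (1 : R) ∈ LinearMap.ker (LinearMap.toSpanSingleton R _ (presOne t r)) := by
      rw [h]; trivial
    simpa using this
  refine Ideal.eq_top_of_forall_isMaximal fun n hn => ?_
  have hJ := annihilatorIdeal_mem_gabrielFilter (U := U) hr
  by_cases hnG : n ∈ gabrielFilter R U
  swap
  · obtain ⟨e, he, hen⟩ := SetLike.not_le_iff_exists.1 fun h => hnG (gabrielFilter_of_le hJ h)
    refine ⟨e, ?_, hen⟩
    rw [LinearMap.mem_ker, LinearMap.toSpanSingleton_apply, ← map_smul, smul_eq_mul,
      mem_annihilatorIdeal.1 he, map_zero]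
  let m : GabrielMax R U := ⟨n, hn, hnG⟩
  obtain ⟨e, k, he, hek⟩ := (ht m).exists_localizer hnil hn hJ 1
  refine ⟨e, ?_, (ht m).not_mem_of_one_sub_mem hn he⟩
  rw [LinearMap.mem_ker, LinearMap.toSpanSingleton_apply, ← map_smul, ← presFrac_unit m k]
  convert map_zero (presFrac t m k)
  refine Fractions.ext ?_ fun i => ?_
  · rw [Fractions.val_unit, smul_eq_mul, map_mul, hr, mul_zero, map_zero]
  · rw [Fractions.coord_unit, map_zero, smul_eq_mul, mul_left_comm, ← mul_assoc]
    exact mem_annihilatorIdeal.1 (hek i.1 i.2)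

theorem exists_smul_presFrac_eq_zero [Module.Flat R U] (hnil : IsHNil (gabrielFilter R U))
    (ht : ∀ m, IsLocalGenerators U m.1 (t m)) {m : GabrielMax R U} {n : ℕ}
    {x : Fractions U (t m) n} (hx : Fractions.val U (t m) n x = 0) :
    ∃ e ∉ m.1, e • presFrac t m n x = 0 := by
  have hT : ∀ i, algebraMap R U (Fractions.coord U n i x) = 0 := fun i => by
    rw [Fractions.algebraMap_coord, hx, smul_zero]
  obtain ⟨e, k, he, hek⟩ := (ht m).exists_localizer hnil m.2.1
    (gabrielFilter_iInf _ fun i => annihilatorIdeal_mem_gabrielFilter (hT i)) 1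
  refine ⟨e, (ht m).not_mem_of_one_sub_mem m.2.1 he, ?_⟩
  rw [← map_smul, ← presFrac_shift (Nat.le_add_right n k)]
  convert map_zero (presFrac t m (n + k))
  refine Fractions.ext ?_ fun i => ?_
  · rw [Fractions.val_shift, map_smul, hx, smul_zero, map_zero]
  · rw [Fractions.coord_shift, map_zero, map_smul, smul_eq_mul, Nat.add_sub_cancel_left, ← mul_assoc,
      mul_comm _ e]
    exact mem_annihilatorIdeal.1 (Ideal.mem_iInf.1 (hek i.1 i.2) i)

/-- Locally at `m` only the tower of `m` survives: for `m' ≠ m` some generator of `m'` is outside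
`m`, and its power carries fractions of `m'` into the image of `R`. -/
theorem exists_smul_eq_presFrac (ht : ∀ m, IsLocalGenerators U m.1 (t m)) (m : GabrielMax R U)
    (x : (R × FracSum t) ⧸ LinearMap.range (relations t)) :
    ∃ e ∉ m.1, ∃ n y, e • x = presFrac t m n y := by
  induction x using pres_induction with
  | h1 r =>
    exact ⟨1, m.2.1.isPrime.one_notMem, 0, Fractions.unit U (t m) 0 r, by
      rw [one_smul, presFrac_unit]⟩
  | h2 m' n x =>
    by_cases h : m' = m
    · subst h
      exact ⟨1, m'.2.1.isPrime.one_notMem, n, x, one_smul _ _⟩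
    · obtain ⟨s, hs, hsm⟩ := (ht m').exists_pow_not_mem m.2.1
        (fun h' => h (Subtype.ext h'.symm)) n
      refine ⟨s ^ n, hsm, 0, Fractions.unit U (t m) 0 (Fractions.coord U n ⟨s, hs⟩ x), ?_⟩
      rw [presFrac_unit, ← presFrac_unit m' n, ← Fractions.pow_smul_eq, map_smul]
  | h3 x y hx hy =>
    obtain ⟨e, he, n, x', hx'⟩ := hx
    obtain ⟨e', he', n', y', hy'⟩ := hy
    refine ⟨e' * e, fun h => (m.2.1.isPrime.mem_or_mem h).elim he' he, n + n',
      e' • Fractions.shift U (t m) (Nat.le_add_right n n') x' +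
        e • Fractions.shift U (t m) (Nat.le_add_left n' n) y', ?_⟩
    rw [map_add, map_smul, map_smul, presFrac_shift, presFrac_shift, ← hx', ← hy', smul_add,
      smul_smul, smul_smul, mul_comm e e']

theorem exists_smul_eq_presOne (ht : ∀ m, IsLocalGenerators U m.1 (t m)) {n : Ideal R}
    (hn : n.IsMaximal) (hnG : n ∉ gabrielFilter R U)
    (x : (R × FracSum t) ⧸ LinearMap.range (relations t)) :
    ∃ e ∉ n, ∃ r, e • x = presOne t r := by
  induction x using pres_induction with
  | h1 r => exact ⟨1, hn.isPrime.one_notMem, r, one_smul _ _⟩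
  | h2 m' k x =>
    obtain ⟨s, hs, hsm⟩ := (ht m').exists_pow_not_mem hn (fun h => hnG (h ▸ m'.2.2)) k
    refine ⟨s ^ k, hsm, Fractions.coord U k ⟨s, hs⟩ x, ?_⟩
    rw [← presFrac_unit m' k, ← Fractions.pow_smul_eq, map_smul]
  | h3 x y hx hy =>
    obtain ⟨e, he, r, hr⟩ := hx
    obtain ⟨e', he', r', hr'⟩ := hy
    refine ⟨e' * e, fun h => (hn.isPrime.mem_or_mem h).elim he' he, e' • r + e • r', ?_⟩
    rw [map_add, map_smul, map_smul, ← hr, ← hr', smul_add, smul_smul, smul_smul, mul_comm e e']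

theorem relations_exact [Module.Flat R U] (hnil : IsHNil (gabrielFilter R U))
    (ht : ∀ m, IsLocalGenerators U m.1 (t m)) :
    Function.Exact (relations t) (toTarget t) := by
  refine LinearMap.exact_iff.2 (le_antisymm ?_ ?_)
  swap
  · rintro _ ⟨x, rfl⟩
    exact toTarget_relations t x
  let q : ((R × FracSum t) ⧸ LinearMap.range (relations t)) →ₗ[R] U :=
    (LinearMap.range (relations t)).liftQ (toTarget t) (by
      rintro _ ⟨x, rfl⟩
      exact toTarget_relations t x)
  have hq1 : ∀ r, q (presOne t r) = algebraMap R U r := toTarget_inl t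
  have hqf : ∀ m n x, q (presFrac t m n x) = Fractions.val U (t m) n x := fun m n x =>
    toTarget_fracIncl t (m, n) x
  intro x hx
  rw [← Submodule.Quotient.mk_eq_zero]
  have hx' : q (Submodule.Quotient.mk x) = 0 := hx
  generalize (Submodule.Quotient.mk x : (R × FracSum t) ⧸ LinearMap.range (relations t)) = y at hx'
  suffices h : LinearMap.ker (LinearMap.toSpanSingleton R _ y) = ⊤ by
    have : (1 : R) ∈ LinearMap.ker (LinearMap.toSpanSingleton R _ y) := by
      rw [h]; trivial
    simpa using this
  refine Ideal.eq_top_of_forall_isMaximal fun n hn => ?_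
  by_cases hnG : n ∈ gabrielFilter R U
  · obtain ⟨e, he, k, z, hz⟩ := exists_smul_eq_presFrac ht ⟨n, hn, hnG⟩ y
    obtain ⟨e', he', hz'⟩ := exists_smul_presFrac_eq_zero hnil ht (m := ⟨n, hn, hnG⟩) (x := z) (by
      rw [← hqf, ← hz, map_smul, hx', smul_zero])
    refine ⟨e' * e, ?_, fun h => (hn.isPrime.mem_or_mem h).elim he' he⟩
    rw [LinearMap.mem_ker, LinearMap.toSpanSingleton_apply, mul_smul, hz, hz']
  · obtain ⟨e, he, r, hr⟩ := exists_smul_eq_presOne ht hn hnG y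
    refine ⟨e, ?_, he⟩
    rw [LinearMap.mem_ker, LinearMap.toSpanSingleton_apply, hr]
    exact presOne_eq_zero hnil ht (by rw [← hq1, ← hr, map_smul, hx', smul_zero])

end Exactness

/-! ### The telescope equations, and basic members of a right closed class. -/

section RightClosed

variable {R : Type u} [CommRing R] {U : Type u} [CommRing U] [Algebra R U]

/-- A map out of the relations with prescribed values `ψ₀`, `ψ` extends along `relations`; `c` and
`φ` are the components of the extension. The hypothesis on `C` enters the hard implication only
through this. -/
theorem exists_telescope_solution [Module.Flat R U] [Algebra.IsEpi R U]
    {t : GabrielMax R U → Finset R} (hnil : IsHNil (gabrielFilter R U))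
    (ht : ∀ m, IsLocalGenerators U m.1 (t m)) {C : ModuleCat.{u} R} (hC : IsWeaklyCotorsion R U C)
    (ψ₀ : GabrielMax R U → C) (ψ : ∀ i : GabrielMax R U × ℕ, Fractions U (t i.1) i.2 →ₗ[R] C) :
    ∃ (c : C) (φ : ∀ i : GabrielMax R U × ℕ, Fractions U (t i.1) i.2 →ₗ[R] C),
      (∀ m, c - φ (m, 0) (Fractions.unit U (t m) 0 1) = ψ₀ m) ∧
      ∀ m n x, φ (m, n) x - φ (m, n + 1) (Fractions.shift U (t m) (Nat.le_succ n) x) =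
        ψ (m, n) x := by
  classical
  have : Subsingleton (Abelian.Ext.{u} (ModuleCat.of R U) C 1) := hC
  obtain ⟨g, hg⟩ := exists_extension_of_subsingleton_ext (relations_injective ht)
    (relations_exact hnil ht) (toTarget_surjective hnil ht) (C := C)
    ((Finsupp.lsum R fun m => LinearMap.toSpanSingleton R C (ψ₀ m)).coprod
      (DirectSum.toModule R _ C ψ))
  refine ⟨g (1, 0), fun i => g ∘ₗ LinearMap.inr R R (FracSum t) ∘ₗ fracIncl t i, fun m => ?_,
    fun m n x => ?_⟩
  · have h := hg (Finsupp.single m 1, 0)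
    have h1 : relations t (Finsupp.single m 1, 0) =
        (1, 0) - (0, fracIncl t (m, 0) (Fractions.unit U (t m) 0 1)) := by simp [relations]
    rw [h1, map_sub] at h
    simpa using h
  · have h := hg (0, fracIncl t (m, n) x)
    have h1 : relations t (0, fracIncl t (m, n) x) = (0, fracIncl t (m, n) x) -
        (0, fracIncl t (m, n + 1) (Fractions.shift U (t m) (Nat.le_succ n) x)) := by
      simp [relations]
      exact telescope_fracIncl t (m, n) x
    rw [h1, map_sub] at h
    simpa [fracIncl] using h

variable {P : ObjectProperty (ModuleCat.{u} R)}

theorem IsRightClosed.of_exact (hP : IsRightClosed P) {A B C : Type u} [AddCommGroup A] [Module R A]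
    [AddCommGroup B] [Module R B] [AddCommGroup C] [Module R C] {i : A →ₗ[R] B} {p : B →ₗ[R] C}
    (hi : Function.Injective i) (he : Function.Exact i p) (hp : Function.Surjective p)
    (hA : P (ModuleCat.of R A)) (hC : P (ModuleCat.of R C)) : P (ModuleCat.of R B) := by
  let S : ShortComplex (ModuleCat.{u} R) := ShortComplex.mk (ModuleCat.ofHom i) (ModuleCat.ofHom p)
    (by ext x; exact he.apply_apply_eq_zero x)
  exact hP.extension S (ModuleCat.shortComplex_shortExact S he hi hp) hA hC

theorem IsRightClosed.of_exact' (hP : IsRightClosed P) {A B C : Type u} [AddCommGroup A]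
    [Module R A] [AddCommGroup B] [Module R B] [AddCommGroup C] [Module R C] {i : A →ₗ[R] B}
    {p : B →ₗ[R] C} (hi : Function.Injective i) (he : Function.Exact i p)
    (hp : Function.Surjective p) (hA : P (ModuleCat.of R A)) (hB : P (ModuleCat.of R B)) :
    P (ModuleCat.of R C) := by
  let S : ShortComplex (ModuleCat.{u} R) := ShortComplex.mk (ModuleCat.ofHom i) (ModuleCat.ofHom p)
    (by ext x; exact he.apply_apply_eq_zero x)
  exact hP.cokernel S (ModuleCat.shortComplex_shortExact S he hi hp) hA hB

theorem property_of_smul_eq_zero (hE : ∀ M, basicModules U M → P M) {I : Ideal R}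
    (hI : I ∈ gabrielFilter R U) {N : Type u} [AddCommGroup N] [Module R N]
    (h : ∀ r ∈ I, ∀ x : N, r • x = 0) : P (ModuleCat.of R N) := by
  have h' : Module.IsTorsionBySet R N I := fun x r => h r r.2 x
  exact hE _ (Or.inr ⟨I, hI, h'.module, h'.isScalarTower⟩)

theorem property_hom (hE : ∀ M, basicModules U M → P M) (C : Type u) [AddCommGroup C]
    [Module R C] : P (ModuleCat.of R (U →ₗ[R] C)) := by
  let inst : Module U (U →ₗ[R] C) :=
    { smul := fun a h => h ∘ₗ LinearMap.mulLeft R a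
      one_smul := fun h => LinearMap.ext fun x => congrArg h (one_mul x)
      mul_smul := fun a b h => LinearMap.ext fun x => congrArg h (by
        simp only [LinearMap.mulLeft_apply]; ring)
      smul_zero := fun a => LinearMap.ext fun x => rfl
      smul_add := fun a h k => LinearMap.ext fun x => rfl
      add_smul := fun a b h => LinearMap.ext fun x =>
        (congrArg h (add_mul a b x)).trans (map_add h _ _)
      zero_smul := fun h => LinearMap.ext fun x => (congrArg h (zero_mul x)).trans (map_zero h) }
  exact hE _ (Or.inl ⟨inst, ⟨fun r a h => LinearMap.ext fun x =>
    (congrArg h (smul_mul_assoc r a x)).trans (map_smul h r _)⟩⟩)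

/-- An isomorphism exhibits `N` as the cokernel of `0 → M`, and the zero module is an `R/⊤`-module.
-/
theorem IsRightClosed.of_equiv (hP : IsRightClosed P) (hE : ∀ M, basicModules U M → P M)
    {M N : Type u} [AddCommGroup M] [Module R M] [AddCommGroup N] [Module R N]
    (e : M ≃ₗ[R] N) (h : P (ModuleCat.of R M)) : P (ModuleCat.of R N) := by
  have h0 : P (ModuleCat.of R (PUnit.{u + 1})) := property_of_smul_eq_zero hE (I := ⊤) (U := U)
    (mem_gabrielFilter_iff.2 (Ideal.map_top _)) fun _ _ _ => rfl
  refine hP.of_exact' (i := (0 : PUnit.{u + 1} →ₗ[R] M)) (p := e.toLinearMap)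
    (Function.injective_of_subsingleton _) (fun x => ?_) e.surjective h0 h
  simp [eq_comm (a := (0 : M))]

end RightClosed

/-! ### Sequential limits as iterated extensions of length ω. -/

section SequentialLimit

variable {R : Type u} [CommRing R] {M : Type u} [AddCommGroup M] [Module R M]

/-- The extension of a decreasing sequence of submodules to all ordinals. -/
def ordinalFiltration (E : ℕ → Submodule R M) (o : Ordinal.{u}) : Submodule R M :=
  ⨅ (n : ℕ) (_ : (n : Ordinal.{u}) ≤ o), E n

theorem ordinalFiltration_antitone (E : ℕ → Submodule R M) : Antitone (ordinalFiltration E) :=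
  fun _ _ h => le_iInf₂ fun n hn => iInf₂_le n (hn.trans h)

theorem ordinalFiltration_natCast {E : ℕ → Submodule R M} (hE : Antitone E) (n : ℕ) :
    ordinalFiltration E n = E n := by
  ext x
  simp only [ordinalFiltration, Submodule.mem_iInf]
  exact ⟨fun h => h n le_rfl, fun h k hk => hE (Nat.cast_le.1 hk) h⟩

theorem ordinalFiltration_omega (E : ℕ → Submodule R M) :
    ordinalFiltration E Ordinal.omega0 = ⨅ n, E n :=
  iInf_congr fun n => iInf_pos (Ordinal.natCast_lt_omega0 n).le

theorem ModuleCat.ofHom_factor_refl {E : Submodule R M} (h : E ≤ E) :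
    ModuleCat.ofHom (Submodule.factor h) = 𝟙 (ModuleCat.of R (M ⧸ E)) := by
  refine ModuleCat.hom_ext (LinearMap.ext fun x => ?_)
  induction x using Submodule.Quotient.induction_on
  rfl

theorem ModuleCat.ofHom_factor_trans {E F G : Submodule R M} (h₁ : E ≤ F) (h₂ : F ≤ G) :
    ModuleCat.ofHom (Submodule.factor (h₁.trans h₂)) =
      ModuleCat.ofHom (Submodule.factor h₁) ≫ ModuleCat.ofHom (Submodule.factor h₂) :=
  ModuleCat.hom_ext (Submodule.factor_comp h₁ h₂).symm

/-- The projective system of quotients by a decreasing family of submodules. -/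
def quotientSystem {ι : Type*} [Preorder ι] (E : ι → Submodule R M) (hE : Antitone E) :
    ιᵒᵖ ⥤ ModuleCat.{u} R where
  obj i := ModuleCat.of R (M ⧸ E i.unop)
  map f := ModuleCat.ofHom (Submodule.factor (hE (leOfHom f.unop)))
  map_id _ := ModuleCat.ofHom_factor_refl _
  map_comp _ _ := ModuleCat.ofHom_factor_trans _ _

/-- The successive kernels are submodules of `M ⧸ E (n + 1)`, whence the form of `hker`. The only
limit ordinal in range is ω, where existence is `hcomplete` and uniqueness holds because the last
stage is the quotient by `⨅ n, E n`. -/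
theorem isIteratedExtension_quotientSystem {P : ObjectProperty (ModuleCat.{u} R)}
    {E : ℕ → Submodule R M} (hE : Antitone E) (h0 : E 0 = ⊤)
    (hcomplete : ∀ x : ℕ → M, (∀ n, x (n + 1) - x n ∈ E n) → ∃ y, ∀ n, y - x n ∈ E n)
    (hker : ∀ (n : ℕ) (K : Submodule R (M ⧸ E (n + 1))), P (ModuleCat.of R K)) :
    IsIteratedExtension P Ordinal.omega0
      (quotientSystem (fun i : Set.Iic Ordinal.omega0.{u} => ordinalFiltration E i.1)
        fun _ _ h => ordinalFiltration_antitone E h) where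
  zero i hi := by
    have : ordinalFiltration E i.1 = ⊤ := by
      rw [hi, ← Nat.cast_zero, ordinalFiltration_natCast hE, h0]
    exact Submodule.Quotient.subsingleton_iff.2 this
  surjective _ _ h _ := Submodule.factor_surjective (ordinalFiltration_antitone E h)
  kernel i k h hk := by
    obtain ⟨n, hn⟩ := Ordinal.lt_omega0.1
      (((Order.lt_succ i.1).trans_eq hk.symm).trans_le k.2)
    have hk' : ordinalFiltration E k.1 = E (n + 1) := by
      rw [hk, hn, ← Nat.cast_succ, ordinalFiltration_natCast hE]
    have key : ∀ (F : Submodule R M) (_ : F = E (n + 1)) (K : Submodule R (M ⧸ F)),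
        P (ModuleCat.of R K) := by
      rintro _ rfl K
      exact hker n K
    exact key _ hk' _
  limit j hj x hx := by
    have hjo : j.1 = Ordinal.omega0 :=
      le_antisymm j.2 (Ordinal.omega0_le_of_isSuccLimit hj)
    have hlt : ∀ n : ℕ, (n : Ordinal.{u}) < j.1 := fun n =>
      (Ordinal.natCast_lt_omega0 n).trans_eq hjo.symm
    let idx : ℕ → Set.Iio j := fun n => ⟨⟨n, (hlt n).le.trans j.2⟩, hlt n⟩
    choose z hz using fun n => Submodule.Quotient.mk_surjective _ (x (idx n))
    have hz' : ∀ n, z (n + 1) - z n ∈ E n := fun n => by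
      have h1 : (idx n).1 ≤ (idx (n + 1)).1 :=
        (Nat.cast_le (α := Ordinal.{u})).2 (Nat.le_succ n)
      have h2 := hx (idx n) (idx (n + 1)) h1
      rw [← hz, ← hz] at h2
      rw [← ordinalFiltration_natCast hE n]
      exact (Submodule.Quotient.eq _).1 h2
    obtain ⟨y, hy⟩ := hcomplete z hz'
    have hidx : ∀ i : Set.Iio j, ∃ n, i = idx n := fun i => by
      obtain ⟨n, hn⟩ := Ordinal.lt_omega0.1 ((show i.1.1 < j.1 from i.2).trans_eq hjo)
      exact ⟨n, Subtype.ext (Subtype.ext hn)⟩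
    refine ⟨Submodule.Quotient.mk y, fun i => ?_, fun y' hy' => ?_⟩
    · obtain ⟨n, rfl⟩ := hidx i
      rw [← hz n]
      refine (Submodule.Quotient.eq _).2 ?_
      have := hy n
      rw [← ordinalFiltration_natCast hE n] at this
      exact this
    · obtain ⟨y', rfl⟩ := Submodule.Quotient.mk_surjective _ y'
      refine (Submodule.Quotient.eq _).2 ?_
      change y' - y ∈ ordinalFiltration E j.1
      rw [hjo, ordinalFiltration_omega, Submodule.mem_iInf]
      intro n
      have h1 := hy' (idx n)
      rw [← hz n] at h1
      have h2 := (Submodule.Quotient.eq _).1 h1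
      have h3 : y' - z n ∈ E n := by
        rw [← ordinalFiltration_natCast hE n]
        exact h2
      have := (E n).sub_mem h3 (hy n)
      rwa [sub_sub_sub_cancel_right] at this

variable {U : Type u} [CommRing U] [Algebra R U] {P : ObjectProperty (ModuleCat.{u} R)}

theorem IsRightClosed.of_complete (hP : IsRightClosed P) (hB : ∀ M, basicModules U M → P M)
    {E : ℕ → Submodule R M} (hE : Antitone E) (h0 : E 0 = ⊤) (hsep : ⨅ n, E n = ⊥)
    (hcomplete : ∀ x : ℕ → M, (∀ n, x (n + 1) - x n ∈ E n) → ∃ y, ∀ n, y - x n ∈ E n)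
    {I : ℕ → Ideal R} (hI : ∀ n, I n ∈ gabrielFilter R U)
    (hIE : ∀ n, ∀ r ∈ I n, ∀ x, r • x ∈ E (n + 1)) : P (ModuleCat.of R M) := by
  have h1 := hP.iteratedExtension _ _ (isIteratedExtension_quotientSystem (P := P) hE h0 hcomplete
    fun n K => property_of_smul_eq_zero hB (hI n) fun r hr x => by
      refine Subtype.ext ?_
      obtain ⟨y, hy⟩ := Submodule.Quotient.mk_surjective _ x.1
      rw [Submodule.coe_smul, ← hy, ← Submodule.Quotient.mk_smul]
      exact (Submodule.Quotient.mk_eq_zero _).2 (hIE n r hr y))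
  have h2 : ordinalFiltration E Ordinal.omega0.{u} = ⊥ := (ordinalFiltration_omega E).trans hsep
  exact hP.of_equiv hB (Submodule.quotEquivOfEqBot _ h2) h1

/-- The limit of the quotients by a decreasing sequence of submodules. -/
def seqLimit (D : ℕ → Submodule R M) (hD : ∀ n, D (n + 1) ≤ D n) :
    Submodule R (∀ n, M ⧸ D n) where
  carrier := {y | ∀ n, Submodule.factor (hD n) (y (n + 1)) = y n}
  zero_mem' n := map_zero _
  add_mem' {x y} hx hy n := by
    rw [Pi.add_apply, map_add, hx n, hy n]; rfl
  smul_mem' r x hx n := by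
    rw [Pi.smul_apply, map_smul, hx n]; rfl

theorem property_seqLimit (hP : IsRightClosed P) (hB : ∀ M, basicModules U M → P M)
    {D : ℕ → Submodule R M} (hD : ∀ n, D (n + 1) ≤ D n)
    {I : ℕ → Ideal R} (hI : ∀ n, I n ∈ gabrielFilter R U)
    (hID : ∀ n, ∀ r ∈ I n, ∀ x, r • x ∈ D n) : P (ModuleCat.of R (seqLimit D hD)) := by
  -- Indices are shifted by one so that the system starts with the zero module.
  let E : ℕ → Submodule R (seqLimit D hD) := fun n => Nat.casesOn n ⊤ fun n =>
    LinearMap.ker (LinearMap.proj n ∘ₗ (seqLimit D hD).subtype)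
  have hE1 : ∀ n x, x ∈ E (n + 1) ↔ x.1 n = 0 := fun n x => Iff.rfl
  refine hP.of_complete hB (E := E) (antitone_nat_of_succ_le fun n => ?_) rfl ?_ ?_ hI ?_
  · cases n with
    | zero => exact le_top
    | succ n =>
      intro x hx
      rw [hE1] at hx ⊢
      rw [← x.2 n, hx, map_zero]
  · refine (Submodule.eq_bot_iff _).2 fun x hx => Subtype.ext (funext fun n => ?_)
    exact (hE1 n x).1 ((Submodule.mem_iInf _).1 hx (n + 1))
  · intro x hx
    have hx' : ∀ n, (x (n + 2)).1 n = (x (n + 1)).1 n := fun n => by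
      have := (hE1 n _).1 (hx (n + 1))
      exact sub_eq_zero.1 this
    refine ⟨⟨fun n => (x (n + 1)).1 n, fun n => ?_⟩, fun n => ?_⟩
    · exact ((x (n + 2)).2 n).trans (hx' n)
    · cases n with
      | zero => trivial
      | succ n => exact (hE1 n _).2 (sub_self ((x (n + 1)).1 n))
  · intro n r hr x
    rw [hE1]
    obtain ⟨y, hy⟩ := Submodule.Quotient.mk_surjective _ (x.1 n)
    change r • x.1 n = 0
    rw [← hy, ← Submodule.Quotient.mk_smul]
    exact (Submodule.Quotient.mk_eq_zero _).2 (hID n r hr y)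

end SequentialLimit

/-! ### Obtaining a weakly cotorsion module from the basic ones. -/

section Obtain

variable {R : Type u} [CommRing R] {U : Type u} [CommRing U] [Algebra R U]
  (t : GabrielMax R U → Finset R) (C : Type u) [AddCommGroup C] [Module R C]

/-- The evaluation at `1` of linear maps out of the modules of fractions. -/
def evalOne (i : GabrielMax R U × ℕ) : (Fractions U (t i.1) i.2 →ₗ[R] C) →ₗ[R] C :=
  LinearMap.applyₗ (Fractions.unit U (t i.1) i.2 1)

/-- The transition maps between the modules of linear maps out of the modules of fractions. -/
def restrictHom (i : GabrielMax R U × ℕ) :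
    (Fractions U (t i.1) (i.2 + 1) →ₗ[R] C) →ₗ[R] (Fractions U (t i.1) i.2 →ₗ[R] C) :=
  LinearMap.lcomp R C (Fractions.shift U (t i.1) (Nat.le_succ i.2))

/-- The restrictions of linear maps vanishing at `1`. -/
def restrictedKernel (i : GabrielMax R U × ℕ) : Submodule R (Fractions U (t i.1) i.2 →ₗ[R] C) :=
  (LinearMap.ker (evalOne t C (i.1, i.2 + 1))).map (restrictHom t C i)

variable {t C}

theorem evalOne_restrictHom (i : GabrielMax R U × ℕ) (φ) :
    evalOne t C i (restrictHom t C i φ) = evalOne t C (i.1, i.2 + 1) φ := by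
  change φ (Fractions.shift U (t i.1) _ (Fractions.unit U (t i.1) i.2 1)) = _
  rw [Fractions.shift_unit]
  rfl

theorem evalOne_eq_zero_of_mem {i : GabrielMax R U × ℕ} {φ} (h : φ ∈ restrictedKernel t C i) :
    evalOne t C i φ = 0 := by
  obtain ⟨b, hb, rfl⟩ := h
  rw [evalOne_restrictHom]
  exact hb

theorem restrictHom_mem {i : GabrielMax R U × ℕ} {φ} (h : evalOne t C (i.1, i.2 + 1) φ = 0) :
    restrictHom t C i φ ∈ restrictedKernel t C i := ⟨φ, h, rfl⟩

theorem smul_mem_of_forall_pow {s : Finset R} {n : ℕ} {N : Type u} [AddCommGroup N] [Module R N]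
    {K : Submodule R N} (h : ∀ i ∈ s, ∀ x : N, i ^ n • x ∈ K) :
    ∀ r ∈ powSpan s n, ∀ x : N, r • x ∈ K := by
  intro r hr x
  have : powSpan s n ≤ K.comap (LinearMap.toSpanSingleton R N x) := by
    rw [powSpan, Ideal.span_le]
    rintro _ ⟨i, hi, rfl⟩
    exact h i hi x
  exact this hr

/-- The map `x ↦ coord x • c` for the numerator at `s` sends `1` to `s ^ n • c`. -/
theorem smul_mem_range_evalOne (i : GabrielMax R U × ℕ) :
    ∀ r ∈ powSpan (t i.1) i.2, ∀ c : C, r • c ∈ LinearMap.range (evalOne t C i) := by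
  refine smul_mem_of_forall_pow fun s hs c => ⟨(LinearMap.toSpanSingleton R C c) ∘ₗ
    Fractions.coord U i.2 ⟨s, hs⟩, ?_⟩
  change Fractions.coord U i.2 ⟨s, hs⟩ (Fractions.unit U (t i.1) i.2 1) • c = _
  rw [Fractions.coord_unit, mul_one]

theorem range_evalOne_succ_le (i : GabrielMax R U × ℕ) :
    LinearMap.range (evalOne t C (i.1, i.2 + 1)) ≤ LinearMap.range (evalOne t C i) := by
  rintro _ ⟨φ, rfl⟩
  exact ⟨_, evalOne_restrictHom i φ⟩

/-- Multiplication by `s ^ n` carries fractions into multiples of `1`, where these maps vanish. -/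
theorem smul_restrictedKernel_eq_zero (i : GabrielMax R U × ℕ) :
    ∀ r ∈ powSpan (t i.1) i.2, ∀ φ : restrictedKernel t C i, r • φ = 0 := by
  intro r hr φ
  rw [← Submodule.mem_bot R]
  refine smul_mem_of_forall_pow (fun s hs φ => ?_) r hr φ
  rw [Submodule.mem_bot]
  obtain ⟨_, b, hb, rfl⟩ := φ
  refine Subtype.ext (LinearMap.ext fun x => ?_)
  change s ^ i.2 • b (Fractions.shift U (t i.1) _ x) = 0
  rw [← map_smul, ← map_smul, Fractions.pow_smul_eq ⟨s, hs⟩, Fractions.shift_unit,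
    ← mul_one (Fractions.coord U i.2 ⟨s, hs⟩ x), ← smul_eq_mul, map_smul, map_smul]
  exact (congrArg _ hb).trans (smul_zero _)

variable (t C) in
/-- Families of linear maps out of the modules of fractions with a common value at `1`, compatible
up to restricted kernels. -/
def almostCompatible :
    Submodule R (C × ∀ i : GabrielMax R U × ℕ, Fractions U (t i.1) i.2 →ₗ[R] C) where
  carrier := {x | ∀ i, evalOne t C i (x.2 i) = x.1 ∧
    x.2 i - restrictHom t C i (x.2 (i.1, i.2 + 1)) ∈ restrictedKernel t C i}
  zero_mem' i := by simp
  add_mem' {x y} hx hy i := by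
    refine ⟨by simp [hx i, hy i], ?_⟩
    have := (restrictedKernel t C i).add_mem (hx i).2 (hy i).2
    rwa [sub_add_sub_comm, ← map_add] at this
  smul_mem' r x hx i := by
    refine ⟨by simp [hx i], ?_⟩
    have := (restrictedKernel t C i).smul_mem r (hx i).2
    rwa [smul_sub, ← map_smul] at this

variable (t C) in
/-- The intersection of the images of all evaluation maps at `1`. -/
def evalCore : Submodule R C := ⨅ i, LinearMap.range (evalOne t C i)

/-- The common value at `1` maps `almostCompatible` onto the core, and the families with value `0`
are precisely the product of the restricted kernels. -/
theorem property_evalCore_of_almostCompatible {P : ObjectProperty (ModuleCat.{u} R)}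
    (hP : IsRightClosed P)
    (h1 : P (ModuleCat.of R (∀ i, restrictedKernel t C i)))
    (h2 : P (ModuleCat.of R (almostCompatible t C))) : P (ModuleCat.of R (evalCore t C)) := by
  let j : (∀ i, restrictedKernel t C i) →ₗ[R] almostCompatible t C :=
    LinearMap.codRestrict _ (LinearMap.inr R C _ ∘ₗ
      LinearMap.pi fun i => (restrictedKernel t C i).subtype ∘ₗ LinearMap.proj i) fun b i =>
        ⟨evalOne_eq_zero_of_mem (b i).2, Submodule.sub_mem _ (b i).2
          (restrictHom_mem (evalOne_eq_zero_of_mem (b (i.1, i.2 + 1)).2))⟩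
  let p : almostCompatible t C →ₗ[R] evalCore t C :=
    LinearMap.codRestrict _ (LinearMap.fst R C _ ∘ₗ (almostCompatible t C).subtype) fun x =>
      (Submodule.mem_iInf _).2 fun i => ⟨_, (x.2 i).1⟩
  refine hP.of_exact' (i := j) (p := p) (fun a b h => ?_) (fun x => ⟨fun hx => ?_, ?_⟩)
    (fun c => ?_) h1 h2
  · funext i
    exact Subtype.ext (congrFun (congrArg (fun z => z.1.2) h) i)
  · have hx0 : x.1.1 = 0 := congrArg Subtype.val hx
    have hz : ∀ i, evalOne t C i (x.1.2 i) = 0 := fun i => (x.2 i).1.trans hx0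
    refine ⟨fun i => ⟨x.1.2 i, ?_⟩, Subtype.ext (Prod.ext hx0.symm rfl)⟩
    have := Submodule.add_mem _ (x.2 i).2 (restrictHom_mem (hz (i.1, i.2 + 1)))
    rwa [sub_add_cancel] at this
  · rintro ⟨b, rfl⟩
    rfl
  · choose a ha using fun i => (Submodule.mem_iInf _).1 c.2 i
    -- Each map is restricted from one level higher, so that its defect is the restriction of a map
    -- vanishing at `1`.
    refine ⟨⟨(c.1, fun i => restrictHom t C i (a (i.1, i.2 + 1))), fun i => ⟨?_, ?_⟩⟩,
      Subtype.ext rfl⟩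
    · exact (evalOne_restrictHom _ _).trans (ha _)
    · change _ - restrictHom t C i (restrictHom t C (i.1, i.2 + 1) (a (i.1, i.2 + 1 + 1))) ∈ _
      rw [← map_sub]
      refine restrictHom_mem ?_
      rw [map_sub]
      refine sub_eq_zero.2 ((ha _).trans ?_)
      exact ((evalOne_restrictHom _ _).trans (ha _)).symm

/-- Strictly compatible families with a common value at `1` are maps out of `U` by the presentation,
and every family of defects in the restricted kernels occurs by solvability of the telescope
equations. -/
theorem property_almostCompatible [Module.Flat R U] [Algebra.IsEpi R U]
    (hnil : IsHNil (gabrielFilter R U)) (ht : ∀ m, IsLocalGenerators U m.1 (t m))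
    {C : ModuleCat.{u} R} (hC : IsWeaklyCotorsion R U C) {P : ObjectProperty (ModuleCat.{u} R)}
    (hP : IsRightClosed P) (h1 : P (ModuleCat.of R (U →ₗ[R] C)))
    (h2 : P (ModuleCat.of R (∀ i, restrictedKernel t C i))) :
    P (ModuleCat.of R (almostCompatible t C)) := by
  classical
  let j : (U →ₗ[R] C) →ₗ[R] almostCompatible t C :=
    LinearMap.codRestrict _ ((LinearMap.applyₗ (1 : U)).prod
      (LinearMap.pi fun i => LinearMap.lcomp R C (Fractions.val U (t i.1) i.2))) fun h i => by
        refine ⟨congrArg h (map_one (algebraMap R U)), ?_⟩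
        convert Submodule.zero_mem _
        exact sub_self (h ∘ₗ Fractions.val U (t i.1) i.2)
  let p : almostCompatible t C →ₗ[R] ∀ i, restrictedKernel t C i :=
    LinearMap.pi fun i => LinearMap.codRestrict _
      ((LinearMap.proj i - restrictHom t C i ∘ₗ LinearMap.proj
        (φ := fun i : GabrielMax R U × ℕ => Fractions U (t i.1) i.2 →ₗ[R] C) (i.1, i.2 + 1)) ∘ₗ
        LinearMap.snd R C _ ∘ₗ (almostCompatible t C).subtype) fun x => (x.2 i).2
  have hp : ∀ x i, (p x i).1 = x.1.2 i - restrictHom t C i (x.1.2 (i.1, i.2 + 1)) :=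
    fun _ _ => rfl
  refine hP.of_exact (i := j) (p := p) (fun a b h => ?_) (fun x => ⟨fun hx => ?_, ?_⟩)
    (fun b => ?_) h1 h2
  · have h3 : a 1 = b 1 := congrArg (fun z => z.1.1) h
    have h4 : ∀ (i : GabrielMax R U × ℕ) (x), a (Fractions.val U (t i.1) i.2 x) = b (Fractions.val U (t i.1) i.2 x) :=
      fun i x => LinearMap.congr_fun (congrFun (congrArg (fun z => z.1.2) h) i) x
    have h5 : a ∘ₗ toTarget t = b ∘ₗ toTarget t := by
      refine LinearMap.prod_ext (LinearMap.ext_ring ?_) (FracSum.hom_ext t fun i x => ?_)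
      · simpa [toTarget_inl] using h3
      · simpa [toTarget_fracIncl] using h4 i x
    exact (LinearMap.cancel_right (toTarget_surjective hnil ht)).1 h5
  · have hc : ∀ i, x.1.2 i = restrictHom t C i (x.1.2 (i.1, i.2 + 1)) := fun i => by
      rw [← sub_eq_zero, ← hp, hx]; rfl
    let F : R × FracSum t →ₗ[R] C := (LinearMap.toSpanSingleton R C x.1.1).coprod
      (DirectSum.toModule R _ C x.1.2)
    have hF1 : ∀ r, F (r, 0) = r • x.1.1 := fun r => by simp [F]
    have hF2 : ∀ i y, F (0, fracIncl t i y) = x.1.2 i y := fun i y => by simp [F, fracIncl]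
    have hF : F ∘ₗ relations t = 0 := by
      refine LinearMap.prod_ext (Finsupp.lhom_ext fun m r => ?_) (FracSum.hom_ext t fun i y => ?_)
      · have : relations t (Finsupp.single m r, 0) =
            (r, 0) - (0, fracIncl t (m, 0) (Fractions.unit U (t m) 0 r)) := by
          simp [relations]
        rw [LinearMap.comp_apply, LinearMap.comp_apply, LinearMap.inl_apply, this, map_sub, hF1,
          hF2, ← (x.2 (m, 0)).1]
        change r • x.1.2 (m, 0) (Fractions.unit U (t m) 0 1) - _ = 0
        rw [← map_smul, ← map_smul, smul_eq_mul, mul_one, sub_self]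
      · have : relations t (0, fracIncl t i y) = (0, fracIncl t i y) -
            (0, fracIncl t (i.1, i.2 + 1) (Fractions.shift U (t i.1) (Nat.le_succ i.2) y)) := by
          simp [relations, telescope_fracIncl]
        rw [LinearMap.comp_apply, LinearMap.inr_apply, LinearMap.comp_apply, this, map_sub, hF2,
          hF2]
        exact sub_eq_zero.2 (LinearMap.congr_fun (hc i) y)
    obtain ⟨g, hg⟩ := LinearMap.exists_factor_of_surjective (relations_exact hnil ht)
      (toTarget_surjective hnil ht) F (LinearMap.congr_fun hF)
    refine ⟨g, Subtype.ext (Prod.ext ?_ (funext fun i => LinearMap.ext fun y => ?_))⟩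
    · change g 1 = x.1.1
      rw [← map_one (algebraMap R U), ← toTarget_inl t, hg, hF1, one_smul]
    · change g (Fractions.val U (t i.1) i.2 y) = x.1.2 i y
      rw [← toTarget_fracIncl, hg, hF2]
  · rintro ⟨h, rfl⟩
    funext i
    exact Subtype.ext (sub_self (h ∘ₗ Fractions.val U (t i.1) i.2))
  -- With constants `0` the bottom maps take the value `c` at `1`; the prescribed defects vanish at
  -- `1`, so this value persists up each tower.
  · obtain ⟨c, φ, h3, h4⟩ := exists_telescope_solution hnil ht hC (fun _ => 0) fun i => (b i).1
    have h4' : ∀ i : GabrielMax R U × ℕ, φ i - restrictHom t C i (φ (i.1, i.2 + 1)) = (b i).1 :=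
      fun i => LinearMap.ext (h4 i.1 i.2)
    have hφ : ∀ m n, evalOne t C (m, n) (φ (m, n)) = c := by
      intro m n
      induction n with
      | zero => exact (sub_eq_zero.1 (h3 m)).symm
      | succ n ih =>
        have h5 := congrArg (evalOne t C (m, n)) (h4' (m, n))
        rw [map_sub, evalOne_restrictHom, ih, evalOne_eq_zero_of_mem (b (m, n)).2] at h5
        exact (sub_eq_zero.1 h5).symm
    refine ⟨⟨(c, φ), fun i => ⟨hφ i.1 i.2, ?_⟩⟩, funext fun i => Subtype.ext (h4' i)⟩
    rw [h4']
    exact (b i).2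

theorem simplyRightObtainable_of_isWeaklyCotorsion [Module.Flat R U] [Algebra.IsEpi R U]
    (hnil : IsHNil (gabrielFilter R U)) {C : ModuleCat.{u} R} (hC : IsWeaklyCotorsion R U C) :
    SimplyRightObtainable (basicModules U) C := by
  intro P hP hE
  choose t ht using fun m : GabrielMax R U => exists_isLocalGenerators hnil m.2.1 m.2.2
  have hG : ∀ i : GabrielMax R U × ℕ, powSpan (t i.1) i.2 ∈ gabrielFilter R U := fun i =>
    powSpan_mem_gabrielFilter (ht i.1).span_mem i.2
  have hK : P (ModuleCat.of R (∀ i, restrictedKernel t C i)) :=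
    hP.product _ (fun i => ModuleCat.of R (restrictedKernel t C i)) fun i =>
      property_of_smul_eq_zero hE (hG i) (smul_restrictedKernel_eq_zero i)
  have hcore : P (ModuleCat.of R (evalCore t C)) := property_evalCore_of_almostCompatible hP hK
    (property_almostCompatible hnil ht hC hP (property_hom hE C) hK)
  let D : GabrielMax R U → ℕ → Submodule R C := fun m n => LinearMap.range (evalOne t C (m, n))
  have hD : ∀ m n, D m (n + 1) ≤ D m n := fun m n => range_evalOne_succ_le (m, n)
  have hlim : P (ModuleCat.of R (∀ m, seqLimit (D m) (hD m))) :=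
    hP.product _ (fun m => ModuleCat.of R (seqLimit (D m) (hD m))) fun m =>
      property_seqLimit hP hE (hD m) (fun n => hG (m, n)) fun n => smul_mem_range_evalOne (m, n)
  let p : C →ₗ[R] ∀ m, seqLimit (D m) (hD m) := LinearMap.pi fun m =>
    LinearMap.codRestrict _ (LinearMap.pi fun n => (D m n).mkQ) fun c n => rfl
  refine hP.of_exact (i := (evalCore t C).subtype) (p := p) (evalCore t C).injective_subtype
    (fun c => ?_) (fun y => ?_) hcore hlim
  · have h1 : p c = 0 ↔ ∀ i : GabrielMax R U × ℕ, c ∈ LinearMap.range (evalOne t C i) := by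
      refine ⟨fun h i => ?_, fun h => funext fun m => Subtype.ext (funext fun n => ?_)⟩
      · exact (Submodule.Quotient.mk_eq_zero _).1 (congrFun (congrArg Subtype.val
          (congrFun h i.1)) i.2)
      · exact (Submodule.Quotient.mk_eq_zero _).2 (h (m, n))
    rw [h1, ← Submodule.mem_iInf]
    exact ⟨fun h => ⟨⟨c, h⟩, rfl⟩, by rintro ⟨y, rfl⟩; exact y.2⟩
  · choose x hx using fun (m : GabrielMax R U) (n : ℕ) =>
      Submodule.Quotient.mk_surjective _ ((y m).1 n)
    have hx' : ∀ i : GabrielMax R U × ℕ, ∃ ψ, evalOne t C i ψ = x i.1 (i.2 + 1) - x i.1 i.2 := by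
      intro i
      have h1 := (y i.1).2 i.2
      rw [← hx, ← hx] at h1
      exact (Submodule.Quotient.eq _).1 h1
    choose ψ hψ using hx'
    -- The defects are chosen with values `x m (n + 1) - x m n` at `1`, so the sum telescopes: `c -
    -- x m n` is the value of `φ (m, n)` at `1` and lies in `D m n`.
    obtain ⟨c, φ, h3, h4⟩ := exists_telescope_solution hnil ht hC (fun m => x m 0) ψ
    have h4' : ∀ i : GabrielMax R U × ℕ, φ i - restrictHom t C i (φ (i.1, i.2 + 1)) = ψ i :=
      fun i => LinearMap.ext (h4 i.1 i.2)
    have hc : ∀ m n, c - x m n = evalOne t C (m, n) (φ (m, n)) := by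
      intro m n
      induction n with
      | zero => rw [← h3 m, sub_sub_cancel]; rfl
      | succ n ih =>
        have h5 := congrArg (evalOne t C (m, n)) (h4' (m, n))
        rw [map_sub, evalOne_restrictHom, hψ, ← ih] at h5
        have h6 := eq_sub_of_add_eq (sub_eq_iff_eq_add'.1 h5).symm
        rw [h6]
        abel
    refine ⟨c, funext fun m => Subtype.ext (funext fun n => ?_)⟩
    refine Eq.trans ?_ (hx m n)
    exact (Submodule.Quotient.eq _).2 ⟨_, (hc m n).symm⟩

end Obtain

theorem proposition6p2 (R U : Type u) [CommRing R] [CommRing U] [Algebra R U]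
    [Module.Flat R U] [Algebra.IsEpi R U] (hnil : IsHNil (gabrielFilter R U)) (C : ModuleCat.{u} R) :
    IsWeaklyCotorsion R U C ↔ SimplyRightObtainable (basicModules U) C :=
  ⟨simplyRightObtainable_of_isWeaklyCotorsion hnil, isWeaklyCotorsion_of_simplyRightObtainable⟩
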